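/- Let $X$ be a closed (compact, connected) Riemann surface, and let $U, W\subset X$ be open subsets with smooth boundary such that $\overline{U}\subset W\subsetneq X$ and such that the inclusion $U\hookrightarrow W$ is a homotopy equivalence (that is, $W$ deformation retracts onto $U$ up to homotopy). Let $Z,P\subset U$ be disjoint discrete sets. Let $(\nu_m)_{m\in\mathbb N}$ and $(\eta_m)_{m\in\mathbb N}$ be two sequences of meromorphic one-forms on $W$ that both converge to one and the same non-zero meromorphic one-form $\omega$ on $W$, uniformly on the compact subsets of $W\setminus P$. Suppose that (i) all of the forms $\nu_m$, $\eta_m$ and $\omega$ have the same set of poles $P$ and the same set of zeros $Z$; (ii) $\operatorname{ord}_z\nu_m=\operatorname{ord}_z\eta_m=\operatorname{ord}_z\omega$ for every $m$ and every $z\in U$; (iii) for each $m$, the classes $[\nu_m]$ and $[\eta_m]$ in the relative cohomology group $H^1(U\setminus P, Z;\mathbb C)$ are equal. Then there are maps $h_m\colon U\to X$ such that, for all sufficiently large $m$, $h_m$ is a conformal map (injective and holomorphic) from $U$ into $W$, it fixes each point of $Z\cup P$, and $h_m^*(\nu_m)=\eta_m$ on $U$; and the $h_m$ converge to the identity, uniformly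 on $U$, as $m\to\infty$. -/

import Mathlib

open Set Filter Topology
open scoped Manifold ContDiff

/-! ## Meromorphic one-forms on a Riemann surface

A Riemann surface is a topological space `X` with `[ChartedSpace ℂ X]` and
`[IsManifold 𝓘(ℂ, ℂ) ω X]`. -/

namespace RiemannSurface

section Forms

variable {X : Type*} [TopologicalSpace X] [ChartedSpace ℂ X]

variable (X) in
/-- A (not necessarily continuous) one-form of type `(1,0)`: a field of complex linear forms on the
holomorphic tangent spaces. -/
abbrev Form : Type _ := (x : X) → (TangentSpace 𝓘(ℂ, ℂ) x →L[ℂ] ℂ)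

/-- The coefficient function of a one-form in a chart `e`: the function `f` on `e.target` such that
`α = f dz` in the coordinate `z = e`. -/
noncomputable def coeff (α : Form X) (e : OpenPartialHomeomorph X ℂ) (z : ℂ) : ℂ :=
  α (e.symm z) (mfderiv 𝓘(ℂ, ℂ) 𝓘(ℂ, ℂ) e.symm z (1 : ℂ))

/-- A meromorphic one-form on `W`: in the coordinate `z` around any point of `W` it is `f dz` with
`f` meromorphic. Values at the individual points are normalised (`MeromorphicNFAt`): the
form has its true value at each point that is not a pole, and the value `0` at each pole.
The values of `toFun` outside `W` are irrelevant. -/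
structure MeromorphicForm (W : Set X) where
  /-- the underlying field of linear forms -/
  toFun : Form X
  meromorphic : ∀ x ∈ W, MeromorphicNFAt (coeff toFun (chartAt ℂ x)) (chartAt ℂ x x)

namespace MeromorphicForm

variable {W : Set X}

/-- The order of a meromorphic form at `x` (`⊤` if it vanishes identically near `x`). -/
noncomputable def ord (α : MeromorphicForm W) (x : X) : WithTop ℤ :=
  meromorphicOrderAt (coeff α.toFun (chartAt ℂ x)) (chartAt ℂ x x)

/-- The set of zeros (in `W`). -/
def zeros (α : MeromorphicForm W) : Set X := {x ∈ W | 0 < α.ord x}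

/-- The set of poles (in `W`). -/
def poles (α : MeromorphicForm W) : Set X := {x ∈ W | α.ord x < 0}

end MeromorphicForm

/-- Uniform convergence on the compact subsets of `S` of a sequence of one-forms: in every chart,
the coefficient functions converge uniformly on each compact set which lies in
(the image under the chart of) `S`. -/
def TendstoUniformlyOnCompacts (ν : ℕ → Form X) (α : Form X) (S : Set X) : Prop :=
  ∀ e ∈ atlas ℂ X, ∀ K ⊆ e.target ∩ e.symm ⁻¹' S, IsCompact K →
    TendstoUniformlyOn (fun m => coeff (ν m) e) (coeff α e) atTop K

/-- The pullback `h^* α` of a one-form. -/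
noncomputable def pullback (h : X → X) (α : Form X) : Form X :=
  fun x => (α (h x)).comp (mfderiv 𝓘(ℂ, ℂ) 𝓘(ℂ, ℂ) h x)

/-! ## Relative de Rham cohomology of a pair `(M, Z)`

`M` is open in `X` and `Z ⊆ M` is a closed discrete subset of `M`. The relative de Rham complex
`Ω^•(M, Z; ℂ)` consists of the smooth complex valued forms on `M` whose restriction to `Z` vanishes:
in degree `0` these are the smooth functions on `M` that vanish on `Z`, and in positive degree
all smooth forms on `M`. -/

variable (X) in
/-- A (not necessarily continuous) complex valued one-form: a field of real linear maps on the
tangent spaces. -/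
def RealForm : Type _ := (x : X) → (TangentSpace 𝓘(ℝ, ℂ) x →L[ℝ] ℂ)

noncomputable instance : AddCommGroup (RealForm X) :=
  inferInstanceAs (AddCommGroup ((x : X) → (TangentSpace 𝓘(ℝ, ℂ) x →L[ℝ] ℂ)))

noncomputable instance : Module ℂ (RealForm X) :=
  inferInstanceAs (Module ℂ ((x : X) → (TangentSpace 𝓘(ℝ, ℂ) x →L[ℝ] ℂ)))

/-- The expression of a complex valued one-form in a chart, that is, its pullback by `e.symm`. -/
noncomputable def realCoeff (α : RealForm X) (e : OpenPartialHomeomorph X ℂ) (z : ℂ) : ℂ →L[ℝ] ℂ :=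
  (α (e.symm z)).comp (mfderiv 𝓘(ℝ, ℂ) 𝓘(ℝ, ℂ) e.symm z : ℂ →L[ℝ] ℂ)

theorem realCoeff_add (α β : RealForm X) (e : OpenPartialHomeomorph X ℂ) :
    realCoeff (α + β) e = realCoeff α e + realCoeff β e := by
  funext z
  exact ContinuousLinearMap.add_comp _ _ _

theorem realCoeff_smul (c : ℂ) (α : RealForm X) (e : OpenPartialHomeomorph X ℂ) :
    realCoeff (c • α) e = c • realCoeff α e := by
  funext z
  exact ContinuousLinearMap.smul_comp _ _ _

/-- The space of closed smooth complex valued one-forms on `M`. (Values outside the open set `M` are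
unconstrained; they disappear in the quotient `RelH1`.) -/
def closedForms (M : Set X) : Submodule ℂ (RealForm X) where
  carrier := {α | ∀ x ∈ M, ContDiffAt ℝ ∞ (realCoeff α (chartAt ℂ x)) (chartAt ℂ x x) ∧
    ∀ v w : ℂ, fderiv ℝ (realCoeff α (chartAt ℂ x)) (chartAt ℂ x x) v w =
      fderiv ℝ (realCoeff α (chartAt ℂ x)) (chartAt ℂ x x) w v}
  zero_mem' := by
    intro x _
    have h : realCoeff (0 : RealForm X) (chartAt ℂ x) = fun _ => 0 := by
      funext z
      exact ContinuousLinearMap.zero_comp _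
    rw [h]
    exact ⟨contDiffAt_const, by simp⟩
  add_mem' := by
    intro α β hα hβ x hx
    obtain ⟨h1, h2⟩ := hα x hx
    obtain ⟨h3, h4⟩ := hβ x hx
    rw [realCoeff_add]
    refine ⟨h1.add h3, fun v w => ?_⟩
    rw [fderiv_add (h1.differentiableAt (by simp)) (h3.differentiableAt (by simp))]
    simp only [add_apply, h2 v w, h4 v w]
  smul_mem' := by
    intro c α hα x hx
    obtain ⟨h1, h2⟩ := hα x hx
    rw [realCoeff_smul]
    refine ⟨contDiffAt_const.smul h1, fun v w => ?_⟩
    rw [fderiv_const_smul (h1.differentiableAt (by simp))]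
    simp only [smul_apply, h2 v w]

/-- The space of the forms `α` with `α = df` on `M` for a smooth function `f` on `M` vanishing
on `Z`. -/
def relExactForms (M Z : Set X) : Submodule ℂ (RealForm X) where
  carrier := {α | ∃ f : X → ℂ, ContMDiffOn 𝓘(ℝ, ℂ) 𝓘(ℝ, ℂ) ∞ f M ∧ (∀ x ∈ Z, f x = 0) ∧
    ∀ x ∈ M, HasMFDerivAt 𝓘(ℝ, ℂ) 𝓘(ℝ, ℂ) f x (α x)}
  zero_mem' := ⟨fun _ => 0, contMDiffOn_const, fun _ _ => rfl, fun x _ => hasMFDerivAt_const _ _⟩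
  add_mem' := by
    rintro α β ⟨f, hf, hfZ, hfα⟩ ⟨g, hg, hgZ, hgβ⟩
    exact ⟨f + g, hf.add hg, fun x hx => by simp [hfZ x hx, hgZ x hx],
      fun x hx => (hfα x hx).add (hgβ x hx)⟩
  smul_mem' := by
    rintro c α ⟨f, hf, hfZ, hfα⟩
    have hL : ContMDiff 𝓘(ℝ, ℂ) 𝓘(ℝ, ℂ) ∞ (fun w : ℂ => c • w) :=
      (contDiff_const_smul c).contMDiff
    refine ⟨fun x => c • f x, hL.comp_contMDiffOn hf, fun x hx => by simp [hfZ x hx],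
      fun x hx => ?_⟩
    have h := ((c • ContinuousLinearMap.id ℝ ℂ).hasFDerivAt (x := f x)).hasMFDerivAt.comp x
      (hfα x hx)
    exact h

/-- The relative cohomology group `H^1(M, Z; ℂ)`, as relative de Rham cohomology: closed one-forms
on `M` modulo differentials of functions that vanish on `Z`. -/
abbrev RelH1 (M Z : Set X) : Type _ :=
  closedForms M ⧸ (relExactForms M Z).comap (closedForms M).subtype

/-- A one-form of type `(1,0)`, regarded as a complex valued one-form. -/
noncomputable def Form.toReal (α : Form X) : RealForm X :=
  fun x => ((α x : ℂ →L[ℂ] ℂ).restrictScalars ℝ : ℂ →L[ℝ] ℂ)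

/-- A holomorphic one-form is smooth and closed. -/
theorem toReal_mem_closedForms [IsManifold 𝓘(ℂ, ℂ) ω X] {α : Form X} {M : Set X}
    (h : ∀ x ∈ M, AnalyticAt ℂ (coeff α (chartAt ℂ x)) (chartAt ℂ x x)) :
    Form.toReal α ∈ closedForms M := by
  intro x hx
  have : IsManifold 𝓘(ℂ, ℂ) 1 X := IsManifold.of_le (n := ω) le_top
  set e := chartAt ℂ x with he
  have key : realCoeff (Form.toReal α) e =ᶠ[𝓝 (e x)]
      fun z => coeff α e z • ContinuousLinearMap.id ℝ ℂ := by
    filter_upwards [e.open_target.mem_nhds (mem_chart_target ℂ x)] with z hz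
    have h1 : HasMFDerivAt 𝓘(ℂ, ℂ) 𝓘(ℂ, ℂ) e.symm z (mfderiv 𝓘(ℂ, ℂ) 𝓘(ℂ, ℂ) e.symm z) :=
      (mdifferentiableAt_atlas_symm (chart_mem_atlas ℂ x) hz).hasMFDerivAt
    have h2 : HasMFDerivAt 𝓘(ℝ, ℂ) 𝓘(ℝ, ℂ) e.symm z
        ((mfderiv 𝓘(ℂ, ℂ) 𝓘(ℂ, ℂ) e.symm z : ℂ →L[ℂ] ℂ).restrictScalars ℝ : ℂ →L[ℝ] ℂ) :=
      ⟨h1.1, h1.2.restrictScalars ℝ⟩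
    refine ContinuousLinearMap.ext fun v => ?_
    unfold realCoeff
    rw [h2.mfderiv]
    change ((α (e.symm z) : ℂ →L[ℂ] ℂ).comp
        (mfderiv 𝓘(ℂ, ℂ) 𝓘(ℂ, ℂ) e.symm z : ℂ →L[ℂ] ℂ) : ℂ →L[ℂ] ℂ) v =
      ((α (e.symm z) : ℂ →L[ℂ] ℂ).comp
        (mfderiv 𝓘(ℂ, ℂ) 𝓘(ℂ, ℂ) e.symm z : ℂ →L[ℂ] ℂ) : ℂ →L[ℂ] ℂ) (1 : ℂ) • v
    rw [smul_eq_mul, mul_comm, ← smul_eq_mul, ← ContinuousLinearMap.map_smul, smul_eq_mul, mul_one]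
  have hc : AnalyticAt ℂ (coeff α e) (e x) := h x hx
  have hd : HasFDerivAt (coeff α e)
      ((fderiv ℂ (coeff α e) (e x)).restrictScalars ℝ) (e x) :=
    hc.differentiableAt.hasFDerivAt.restrictScalars ℝ
  refine ⟨ContDiffAt.congr_of_eventuallyEq ?_ key, fun v w => ?_⟩
  · exact (hc.contDiffAt.restrict_scalars ℝ).smul contDiffAt_const
  · rw [key.fderiv_eq, (hd.smul_const (ContinuousLinearMap.id ℝ ℂ)).fderiv]
    change (fderiv ℂ (coeff α e) (e x) v) • w = (fderiv ℂ (coeff α e) (e x) w) • v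
    rw [fderiv_eq_smul_deriv, fderiv_eq_smul_deriv]
    simp only [smul_eq_mul]
    ring

namespace MeromorphicForm

variable {W : Set X}

theorem analyticAt_of_not_mem_poles (α : MeromorphicForm W) {x : X} (hx : x ∈ W)
    (hp : x ∉ α.poles) : AnalyticAt ℂ (coeff α.toFun (chartAt ℂ x)) (chartAt ℂ x x) := by
  refine (α.meromorphic x hx).meromorphicOrderAt_nonneg_iff_analyticAt.1 ?_
  by_contra hneg
  exact hp ⟨hx, not_le.1 hneg⟩

/-- The class in `H^1(M, Z; ℂ)` of a meromorphic one-form on `W` without poles on `M ⊆ W`. -/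
noncomputable def relClass [IsManifold 𝓘(ℂ, ℂ) ω X] (α : MeromorphicForm W) {M : Set X}
    (hM : M ⊆ W \ α.poles) (Z : Set X) : RelH1 M Z :=
  Submodule.Quotient.mk ⟨Form.toReal α.toFun,
    toReal_mem_closedForms fun _ hx => α.analyticAt_of_not_mem_poles (hM hx).1 (hM hx).2⟩

end MeromorphicForm

/-! ## Domains and maps -/

/-- `U` is an open set with smooth boundary: near each boundary point it is a sublevel set
`{ρ < 0}` of a smooth real function `ρ` with non-vanishing differential at that point. -/
def IsSmoothDomain (U : Set X) : Prop :=
  IsOpen U ∧ ∀ p ∈ frontier U, ∃ V : Set X, IsOpen V ∧ p ∈ V ∧ ∃ ρ : X → ℝ,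
    ContMDiffOn 𝓘(ℝ, ℂ) 𝓘(ℝ, ℝ) ∞ ρ V ∧ mfderiv 𝓘(ℝ, ℂ) 𝓘(ℝ, ℝ) ρ p ≠ 0 ∧
      ∀ x ∈ V, x ∈ U ↔ ρ x < 0

/-- `h` restricts to a conformal map from the open set `U` into `W`: a holomorphic map that is
biholomorphic onto its image, that is, injective. -/
def IsConformalMap (h : X → X) (U W : Set X) : Prop :=
  MapsTo h U W ∧ MDifferentiableOn 𝓘(ℂ, ℂ) 𝓘(ℂ, ℂ) h U ∧ InjOn h U

end Forms

/-- The inclusion `U ⊆ W` is a homotopy equivalence. -/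
def InclusionIsHomotopyEquiv {X : Type*} [TopologicalSpace X] (U W : Set X) : Prop :=
  ∃ e : ContinuousMap.HomotopyEquiv U W, ∀ x : U, ((e x : W) : X) = x

/-- Uniform convergence on `U` of self-maps of a compact Hausdorff space to the identity, for the
unique uniform structure that induces the topology. -/
def TendstoUniformlyToId {X : Type*} [TopologicalSpace X] [CompactSpace X] [T2Space X]
    (h : ℕ → X → X) (U : Set X) : Prop :=
  letI : UniformSpace X := uniformSpaceOfCompactR1
  TendstoUniformlyOn h id atTop U

/-- Elementary bookkeeping for the domain of the cohomology classes. -/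
theorem diff_subset_diff_poles {X : Type*} [TopologicalSpace X] [ChartedSpace ℂ X] {U W P : Set X}
    (hUW : closure U ⊆ W) {α : MeromorphicForm W} (hα : α.poles = P) : U \ P ⊆ W \ α.poles :=
  fun _ hx => ⟨hUW (subset_closure hx.1), hα ▸ hx.2⟩

end RiemannSurface

/-!
The map `h` with `h^* ν = η` is found as the solution of an integral equation. On `U \ P` equality
of the relative classes gives a function `g` with `dg = η - ν` that vanishes on `Z`, and a map `h`
close to the identity satisfies `h^* ν = η` as soon as `∫_x^{h(x)} ν = g(x)`, the integral being
taken along a short path: differentiate both sides. Away from the zeros and poles of `ν` such an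
`h(x)` exists and is unique, because a primitive of `ν` is a local coordinate, so only the size of
`g` matters.

*Smallness of `g`.* After `g m` has been corrected by constants on the components of `U \ P` that
do not meet `Z`, the sequence tends to zero uniformly on compact subsets of `U \ P`: its
differentials do, and each component contains a point at which all `g m` vanish
(`exists_primitives_tendsto_zero`). Near a boundary point of `U`, where uniformity on compact
subsets is not enough, `U` meets small discs in a connected set
(`IsSmoothDomain.eventually_isPreconnected`), so that `g m` extends to the whole disc as a primitive
of `η m - ν m`, and the extension is small. Near a zero or pole of order `n` the maximum principle
gives `|g m (w)| ≤ ε |w| ^ (n + 1)` (`eventually_norm_le_zpow`); this uses that the orders of `ν m`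
and `η m` are `n` and that `g m` vanishes on `Z`.

*Solution.* On a disc around a point of `closure U`, the form `ν m` is close to a monomial
`α (w - o) ^ n`, where `o` is the centre if that is a zero or pole and lies outside the disc,
with `n = 0`, otherwise. On the ball around `w` of radius proportional to `|w - o|` this monomial is
nearly constant, so a primitive of `ν m` is injective there and its image contains a ball of radius
proportional to `|w - o| ^ (n + 1)`. Hence the equation is solvable with `|h w - w| ≤ τ |w - o|`
(`exists_solution`), and the singularity at `o` is removable.

*Gluing.* By uniqueness, solutions on two discs agree on the overlap
(`LocalSolution.eventually_eq`), and finitely many discs cover `closure U`. By Cauchy's estimate the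
solutions are injective on smaller discs (`eventually_injOn_of_tendsto_id`); since two points of `U`
with the same image are close to each other, the glued map is injective
(`ConvergingPair.exists_conformal`).
-/

namespace RiemannSurface

/-! ### Holomorphic functions of one variable -/

/-- A function whose derivative stays within `‖l‖ / 2` of a constant `l` on a convex set expands
distances by at least `‖l‖ / 2`. -/
theorem norm_sub_le_of_hasDerivAt_near_const {F a : ℂ → ℂ} {s : Set ℂ} {l : ℂ}
    (hs : Convex ℝ s) (hF : ∀ t ∈ s, HasDerivAt F (a t) t) (ha : ∀ t ∈ s, ‖a t - l‖ ≤ ‖l‖ / 2)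
    {x y : ℂ} (hx : x ∈ s) (hy : y ∈ s) : ‖l‖ / 2 * ‖x - y‖ ≤ ‖F x - F y‖ := by
  have h1 : ∀ t ∈ s, HasDerivWithinAt (fun t => F t - l * t) (a t - l) s t := fun t ht => by
    simpa using ((hF t ht).fun_sub ((hasDerivAt_id t).const_mul l)).hasDerivWithinAt
  have h2 := hs.norm_image_sub_le_of_norm_hasDerivWithin_le h1 ha hy hx
  have h3 : ‖l * (x - y)‖ ≤ ‖F x - F y‖ + ‖(F x - l * x) - (F y - l * y)‖ := by
    have : l * (x - y) = (F x - F y) - ((F x - l * x) - (F y - l * y)) := by ring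
    rw [this]
    exact norm_sub_le _ _
  rw [norm_mul] at h3
  linarith

theorem eq_of_hasDerivAt_near_const {F a : ℂ → ℂ} {s : Set ℂ} {l : ℂ} (hl : l ≠ 0)
    (hs : Convex ℝ s) (hF : ∀ t ∈ s, HasDerivAt F (a t) t) (ha : ∀ t ∈ s, ‖a t - l‖ ≤ ‖l‖ / 2)
    {x y : ℂ} (hx : x ∈ s) (hy : y ∈ s) (hxy : F x = F y) : x = y := by
  have h := norm_sub_le_of_hasDerivAt_near_const hs hF ha hx hy
  rw [hxy, sub_self, norm_zero] at h
  have hl' := norm_pos_iff.2 hl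
  have : ‖x - y‖ ≤ 0 := by
    by_contra hc
    have := mul_pos (half_pos hl') (not_le.1 hc)
    linarith
  exact sub_eq_zero.1 (norm_le_zero_iff.1 this)

/-- A function whose derivative is close to a constant `l` attains all values near `F w`. -/
theorem exists_eq_of_hasDerivAt_near_const {F a : ℂ → ℂ} {l w v : ℂ} {r : ℝ} (hl : l ≠ 0)
    (hF : ∀ t ∈ Metric.ball w r, HasDerivAt F (a t) t)
    (ha : ∀ t ∈ Metric.ball w r, ‖a t - l‖ ≤ ‖l‖ / 2)
    (hv : ‖v‖ < ‖l‖ / 8 * r) : ∃ y ∈ Metric.ball w r, F y - F w = v := by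
  have hl' := norm_pos_iff.2 hl
  have hr : 0 < r := by
    have : 0 < ‖l‖ / 8 * r := (norm_nonneg v).trans_lt hv
    exact pos_of_mul_pos_right this (by positivity)
  have hsub : Metric.closedBall w (r / 2) ⊆ Metric.ball w r :=
    Metric.closedBall_subset_ball (half_lt_self hr)
  have hw : w ∈ Metric.ball w r := Metric.mem_ball_self hr
  have hd : DiffContOnCl ℂ F (Metric.ball w (r / 2)) := by
    refine DifferentiableOn.diffContOnCl fun t ht => ?_
    rw [closure_ball _ (half_pos hr).ne'] at ht
    exact (hF t (hsub ht)).differentiableAt.differentiableWithinAt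
  have hsph : ∀ z ∈ Metric.sphere w (r / 2), ‖l‖ / 2 * (r / 2) ≤ ‖F z - F w‖ := by
    intro z hz
    have h := norm_sub_le_of_hasDerivAt_near_const (convex_ball w r) hF ha
      (hsub (Metric.sphere_subset_closedBall hz)) hw
    rwa [mem_sphere_iff_norm.1 hz] at h
  have hfreq : ∃ᶠ z in 𝓝 w, F z ≠ F w := by
    have h1 : ∃ᶠ z in 𝓝 w, z ≠ w := by
      have : (𝓝[≠] w).NeBot := inferInstance
      exact mem_closure_iff_frequently.1 (mem_closure_iff_nhdsWithin_neBot.2 this)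
    refine (h1.and_eventually (Metric.ball_mem_nhds w hr)).mono fun z hz hzw => hz.1 ?_
    exact eq_of_hasDerivAt_near_const hl (convex_ball w r) hF ha hz.2 hw hzw
  have hmem : F w + v ∈ Metric.ball (F w) (‖l‖ / 2 * (r / 2) / 2) := by
    rw [mem_ball_iff_norm, add_sub_cancel_left]
    linarith
  obtain ⟨y, hy, hyv⟩ := hd.ball_subset_image_closedBall (half_pos hr) hsph hfreq hmem
  exact ⟨y, hsub hy, by rw [hyv]; ring⟩

/-- Differentiability of a continuous solution `h` of `F ∘ h = E`. -/
theorem hasDerivAt_of_comp_eq {F h E : ℂ → ℂ} {F' E' w : ℂ} (hF : HasStrictDerivAt F F' (h w))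
    (hF' : F' ≠ 0) (hh : ContinuousAt h w) (hE : HasDerivAt E E' w)
    (hFE : ∀ᶠ t in 𝓝 w, F (h t) = E t) : HasDerivAt h (E' / F') w := by
  have h1 : ∀ᶠ t in 𝓝 w, hF.localInverse F F' (h w) hF' (F (h t)) = h t :=
    hh.eventually (hF.hasStrictFDerivAt_equiv hF').eventually_left_inverse
  have h2 : HasDerivAt (hF.localInverse F F' (h w) hF') F'⁻¹ (E w) := by
    rw [← hFE.self_of_nhds]
    exact (hF.to_localInverse hF').hasDerivAt
  have h3 := h2.comp w hE
  have h4 : h =ᶠ[𝓝 w] hF.localInverse F F' (h w) hF' ∘ E := by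
    filter_upwards [h1, hFE] with t ht1 ht2
    rw [Function.comp_apply, ← ht2, ht1]
  rw [div_eq_inv_mul]
  exact h3.congr_of_eventuallyEq h4

/-- Two primitives of one function on a convex set differ by a constant. -/
theorem sub_eq_sub_of_hasDerivAt {F G a : ℂ → ℂ} {s : Set ℂ} (hs : Convex ℝ s)
    (hF : ∀ t ∈ s, HasDerivAt F (a t) t) (hG : ∀ t ∈ s, HasDerivAt G (a t) t)
    {x y : ℂ} (hx : x ∈ s) (hy : y ∈ s) : F x - F y = G x - G y := by
  have h1 : ∀ t ∈ s, HasDerivWithinAt (fun t => F t - G t) 0 s t := fun t ht => by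
    simpa using ((hF t ht).fun_sub (hG t ht)).hasDerivWithinAt
  have h2 := hs.norm_image_sub_le_of_norm_hasDerivWithin_le (C := 0) h1 (by simp) hy hx
  rw [zero_mul] at h2
  have h3 := sub_eq_zero.1 (norm_le_zero_iff.1 h2)
  linear_combination h3

/-- `a` is, up to a relative error `1 / 8`, equal to `α (w - o) ^ n` on `s \ {o}`. -/
def NearMonomial (a : ℂ → ℂ) (o α : ℂ) (n : ℤ) (s : Set ℂ) : Prop :=
  ∀ w ∈ s, w ≠ o → ‖a w - α * (w - o) ^ n‖ ≤ ‖α * (w - o) ^ n‖ / 8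

/-- A factor by which a ball around `w` has to be small compared to the distance of `w` from `o`
in order that `(t - o) ^ n` varies little on it. -/
theorem exists_norm_one_add_zpow_sub_one_le (n : ℤ) :
    ∃ ρ : ℝ, 0 < ρ ∧ ρ ≤ 1 / 2 ∧ ∀ s : ℂ, ‖s‖ ≤ ρ → ‖(1 + s) ^ n - 1‖ ≤ 1 / 8 := by
  have hc : ContinuousAt (fun s : ℂ => (1 + s) ^ n - 1) 0 := by
    refine ((continuousAt_const.add continuousAt_id).zpow₀ n (Or.inl (by simp))).sub
      continuousAt_const
  have h := Metric.continuousAt_iff.1 hc (1 / 8) (by norm_num)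
  obtain ⟨δ, hδ, h⟩ := h
  refine ⟨min (δ / 2) (1 / 2), by positivity, min_le_right _ _, fun s hs => ?_⟩
  have := h (x := s) (by
    rw [dist_zero_right]
    exact hs.trans_lt ((min_le_left _ _).trans_lt (half_lt_self hδ)))
  simpa [dist_eq_norm] using this.le

/-- On a ball around `w` that is small compared to the distance of `w` from `o`, the function is
close to the constant `α * (w - o) ^ n`. -/
theorem NearMonomial.norm_sub_le {a : ℂ → ℂ} {o α : ℂ} {n : ℤ} {s : Set ℂ}
    (ha : NearMonomial a o α n s) {ρ : ℝ} (hρ : ρ ≤ 1 / 2)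
    (hn : ∀ s : ℂ, ‖s‖ ≤ ρ → ‖(1 + s) ^ n - 1‖ ≤ 1 / 8) {w : ℂ} (hw : w ≠ o)
    {t : ℂ} (ht : t ∈ Metric.ball w (ρ * ‖w - o‖)) (hts : t ∈ s) :
    t ≠ o ∧ ‖a t - α * (w - o) ^ n‖ ≤ ‖α * (w - o) ^ n‖ / 2 := by
  have hwo : w - o ≠ 0 := sub_ne_zero.2 hw
  have hwo' := norm_pos_iff.2 hwo
  rw [mem_ball_iff_norm] at ht
  set q : ℂ := (t - w) / (w - o) with hq
  have hqn : ‖q‖ ≤ ρ := by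
    rw [hq, norm_div, div_le_iff₀ hwo']
    exact ht.le
  have hto : t - o = (w - o) * (1 + q) := by
    rw [hq]
    field_simp
    ring
  have hto' : t ≠ o := by
    rintro rfl
    rw [norm_sub_rev] at ht
    nlinarith
  refine ⟨hto', ?_⟩
  have h1 := ha t hts hto'
  have h2 : ‖(1 + q) ^ n - 1‖ ≤ 1 / 8 := hn q hqn
  have h3 : α * (t - o) ^ n - α * (w - o) ^ n = α * (w - o) ^ n * ((1 + q) ^ n - 1) := by
    rw [hto, mul_zpow]
    ring
  have h4 : ‖α * (t - o) ^ n - α * (w - o) ^ n‖ ≤ ‖α * (w - o) ^ n‖ * (1 / 8) := by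
    rw [h3, norm_mul]
    gcongr
  have h5 : ‖α * (t - o) ^ n‖ ≤ ‖α * (w - o) ^ n‖ + ‖α * (t - o) ^ n - α * (w - o) ^ n‖ := by
    have := norm_add_le (α * (w - o) ^ n) (α * (t - o) ^ n - α * (w - o) ^ n)
    rwa [add_sub_cancel] at this
  have h6 : ‖a t - α * (w - o) ^ n‖ ≤
      ‖a t - α * (t - o) ^ n‖ + ‖α * (t - o) ^ n - α * (w - o) ^ n‖ := by
    have := norm_add_le (a t - α * (t - o) ^ n) (α * (t - o) ^ n - α * (w - o) ^ n)
    rwa [sub_add_sub_cancel] at this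
  have h7 := norm_nonneg (α * (w - o) ^ n)
  linarith

/-- Solution of `∫_w^{h(w)} a = G(w)` with `h(w)` close to `w`, for a function `a` that is close to
a monomial. The solution is holomorphic off `o`, and `a(h) h' = b` when `G' = b - a`. -/
theorem exists_solution {a b G : ℂ → ℂ} {o α : ℂ} {n : ℤ} {s r : Set ℂ} {ρ : ℝ}
    (hα : α ≠ 0) (hr : IsOpen r) (ha : NearMonomial a o α n s)
    (hρ0 : 0 < ρ) (hρ : ρ ≤ 1 / 2) (hn : ∀ s : ℂ, ‖s‖ ≤ ρ → ‖(1 + s) ^ n - 1‖ ≤ 1 / 8)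
    (hda : DifferentiableOn ℂ a (s \ {o}))
    (hrs : ∀ w ∈ r, Metric.ball w (ρ * ‖w - o‖) ⊆ s)
    (hG : ∀ w ∈ r, w ≠ o → HasDerivAt G (b w - a w) w)
    (hGs : ∀ w ∈ r, w ≠ o → ‖G w‖ < ‖α * (w - o) ^ n‖ / 64 * (ρ * ‖w - o‖)) :
    ∃ h : ℂ → ℂ, h o = o ∧ ∀ w ∈ r, w ≠ o →
      ‖h w - w‖ * ‖α * (w - o) ^ n‖ ≤ 2 * ‖G w‖ ∧ HasDerivAt h (b w / a (h w)) w ∧ a (h w) ≠ 0 ∧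
      ∃ F : ℂ → ℂ, (∀ t ∈ Metric.ball w (ρ * ‖w - o‖), HasDerivAt F (a t) t) ∧
        InjOn F (Metric.ball w (ρ * ‖w - o‖)) ∧ h w ∈ Metric.ball w (ρ * ‖w - o‖) ∧
        F (h w) - F w = G w := by
  have hl : ∀ w, w ≠ o → α * (w - o) ^ n ≠ 0 := fun w hw =>
    mul_ne_zero hα (zpow_ne_zero _ (sub_ne_zero.2 hw))
  have hpos : ∀ w, w ≠ o → 0 < ρ * ‖w - o‖ := fun w hw =>
    mul_pos hρ0 (norm_pos_iff.2 (sub_ne_zero.2 hw))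
  have hprim : ∀ w ∈ r, w ≠ o → ∃ F : ℂ → ℂ,
      ∀ t ∈ Metric.ball w (ρ * ‖w - o‖), HasDerivAt F (a t) t := by
    intro w hw hwo
    refine DifferentiableOn.isExactOn_ball (hda.mono fun t ht => ?_)
    exact ⟨hrs w hw ht, (ha.norm_sub_le hρ hn hwo ht (hrs w hw ht)).1⟩
  have hnear : ∀ w ∈ r, w ≠ o → ∀ t ∈ Metric.ball w (ρ * ‖w - o‖),
      ‖a t - α * (w - o) ^ n‖ ≤ ‖α * (w - o) ^ n‖ / 2 := fun w hw hwo t ht =>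
    (ha.norm_sub_le hρ hn hwo ht (hrs w hw ht)).2
  choose! F hF using hprim
  have hy : ∀ w, ∃ y, w ∈ r → w ≠ o → y ∈ Metric.ball w (ρ / 8 * ‖w - o‖) ∧
      F w y - F w w = G w := by
    intro w
    by_cases hw : w ∈ r ∧ w ≠ o
    · have hsub : Metric.ball w (ρ / 8 * ‖w - o‖) ⊆ Metric.ball w (ρ * ‖w - o‖) :=
        Metric.ball_subset_ball (by have := hpos w hw.2; linarith)
      obtain ⟨y, hy1, hy2⟩ := exists_eq_of_hasDerivAt_near_const (r := ρ / 8 * ‖w - o‖)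
        (v := G w) (hl w hw.2)
        (fun t ht => hF w hw.1 hw.2 t (hsub ht)) (fun t ht => hnear w hw.1 hw.2 t (hsub ht))
        (by have := hGs w hw.1 hw.2; linarith)
      exact ⟨y, fun _ _ => ⟨hy1, hy2⟩⟩
    · exact ⟨w, fun h1 h2 => absurd ⟨h1, h2⟩ hw⟩
  choose h' hh' using hy
  set h : ℂ → ℂ := Function.update h' o o with hh
  have hh1 : ∀ w ∈ r, w ≠ o → h w ∈ Metric.ball w (ρ / 8 * ‖w - o‖) ∧
      F w (h w) - F w w = G w := by
    intro w hw hwo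
    rw [hh, Function.update_of_ne hwo]
    exact hh' w hw hwo
  refine ⟨h, by simp [hh], fun w hw hwo => ?_⟩
  have hw0 := hpos w hwo
  have hsub : Metric.ball w (ρ / 8 * ‖w - o‖) ⊆ Metric.ball w (ρ * ‖w - o‖) :=
    Metric.ball_subset_ball (by linarith)
  have hwmem : w ∈ Metric.ball w (ρ * ‖w - o‖) := Metric.mem_ball_self hw0
  have hhw := hsub (hh1 w hw hwo).1
  have hl2 := norm_pos_iff.2 (hl w hwo)
  have hane : ∀ t ∈ Metric.ball w (ρ * ‖w - o‖), a t ≠ 0 := by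
    intro t ht h0
    have := hnear w hw hwo t ht
    rw [h0, zero_sub, norm_neg] at this
    linarith
  -- near `w`, the number `h x` also solves the equation for the primitive chosen at `w`
  have hev : ∀ᶠ x in 𝓝 w, h x ∈ Metric.ball w (ρ * ‖w - o‖) ∧ x ∈ Metric.ball w (ρ * ‖w - o‖) ∧
      F w (h x) = F w x + G x := by
    have h1 : ∀ᶠ x in 𝓝 w, ‖x - w‖ < ρ / 8 * ‖w - o‖ := by
      have := Metric.ball_mem_nhds w (show 0 < ρ / 8 * ‖w - o‖ by linarith)
      filter_upwards [this] with x hx using mem_ball_iff_norm.1 hx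
    filter_upwards [h1, hr.mem_nhds hw, isOpen_ne.mem_nhds hwo] with x hx1 hx2 hx3
    have hxo : ‖x - o‖ ≤ 2 * ‖w - o‖ := by
      have : ‖x - o‖ ≤ ‖x - w‖ + ‖w - o‖ := norm_sub_le_norm_sub_add_norm_sub x w o
      have : ρ / 8 * ‖w - o‖ ≤ ‖w - o‖ := by
        have := norm_nonneg (w - o)
        nlinarith
      linarith
    have hsub2 : Metric.ball x (ρ / 8 * ‖x - o‖) ⊆ Metric.ball w (ρ * ‖w - o‖) := by
      intro t ht
      rw [mem_ball_iff_norm] at ht ⊢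
      have h2 : ‖t - w‖ ≤ ‖t - x‖ + ‖x - w‖ := norm_sub_le_norm_sub_add_norm_sub t x w
      have h3 : ρ / 8 * ‖x - o‖ ≤ ρ / 8 * (2 * ‖w - o‖) := by gcongr
      nlinarith
    have hxm : x ∈ Metric.ball x (ρ / 8 * ‖x - o‖) :=
      Metric.mem_ball_self (by have := hpos x hx3; linarith)
    obtain ⟨hx4, hx5⟩ := hh1 x hx2 hx3
    have hsub3 : Metric.ball x (ρ / 8 * ‖x - o‖) ⊆ Metric.ball x (ρ * ‖x - o‖) :=
      Metric.ball_subset_ball (by have := hpos x hx3; linarith)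
    refine ⟨hsub2 hx4, hsub2 hxm, ?_⟩
    have h6 := sub_eq_sub_of_hasDerivAt (convex_ball x (ρ / 8 * ‖x - o‖))
      (fun t ht => hF w hw hwo t (hsub2 ht)) (fun t ht => hF x hx2 hx3 t (hsub3 ht)) hx4 hxm
    rw [← hx5, ← h6]
    ring
  have hFc : HasDerivAt (fun x => F w x + G x) (b w) w := by
    simpa using (hF w hw hwo w hwmem).fun_add (hG w hw hwo)
  have hcont : ContinuousAt h w := by
    have h1 : Tendsto (fun x => 2 / ‖α * (w - o) ^ n‖ * ‖(F w x + G x) - (F w w + G w)‖)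
        (𝓝 w) (𝓝 0) := by
      have : Tendsto (fun x => (F w x + G x) - (F w w + G w)) (𝓝 w) (𝓝 0) := by
        have := hFc.continuousAt.tendsto.sub_const (F w w + G w)
        rwa [sub_self] at this
      simpa using this.norm.const_mul (2 / ‖α * (w - o) ^ n‖)
    rw [ContinuousAt, tendsto_iff_norm_sub_tendsto_zero]
    refine squeeze_zero' (Eventually.of_forall fun x => norm_nonneg _) ?_ h1
    filter_upwards [hev] with x hx
    have h2 := norm_sub_le_of_hasDerivAt_near_const (convex_ball w (ρ * ‖w - o‖))
      (hF w hw hwo) (hnear w hw hwo) hx.1 hhw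
    rw [hx.2.2, hev.self_of_nhds.2.2] at h2
    rw [div_mul_eq_mul_div, le_div_iff₀ hl2]
    linarith
  have hstrict : HasStrictDerivAt (F w) (a (h w)) (h w) := by
    have han : AnalyticAt ℂ (F w) (h w) := by
      refine DifferentiableOn.analyticAt (s := Metric.ball w (ρ * ‖w - o‖)) (fun t ht =>
        (hF w hw hwo t ht).differentiableAt.differentiableWithinAt)
        (Metric.isOpen_ball.mem_nhds hhw)
    have := han.hasStrictDerivAt
    rwa [(hF w hw hwo _ hhw).deriv] at this
  refine ⟨?_, ?_, hane _ hhw, F w, hF w hw hwo, ?_, hhw, (hh1 w hw hwo).2⟩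
  · have := norm_sub_le_of_hasDerivAt_near_const (convex_ball w (ρ * ‖w - o‖))
      (hF w hw hwo) (hnear w hw hwo) hhw hwmem
    rw [(hh1 w hw hwo).2] at this
    linarith
  · exact hasDerivAt_of_comp_eq hstrict (hane _ hhw) hcont hFc (hev.mono fun x hx => hx.2.2)
  · intro x hx y hy hxy
    exact eq_of_hasDerivAt_near_const (hl w hwo) (convex_ball w _) (hF w hw hwo)
      (hnear w hw hwo) hx hy hxy

end RiemannSurface

namespace RiemannSurface

/-- Maximum principle on a disc whose centre is a removable singularity. -/
theorem norm_le_of_forall_sphere_of_order_nonneg {φ : ℂ → ℂ} {c : ℂ} {R R' C : ℝ} (hR : 0 < R)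
    (hRR' : R < R') (hd : DifferentiableOn ℂ φ (Metric.ball c R' \ {c})) (hm : MeromorphicAt φ c)
    (ho : 0 ≤ meromorphicOrderAt φ c) (hC : ∀ z ∈ Metric.sphere c R, ‖φ z‖ ≤ C)
    {w : ℂ} (hw : w ∈ Metric.closedBall c R) (hwc : w ≠ c) : ‖φ w‖ ≤ C := by
  obtain ⟨g, hg, hφg⟩ := hm.meromorphicOrderAt_nonneg_iff.1 ho
  set ψ := Function.update φ c (g c) with hψ
  have hψg : ψ =ᶠ[𝓝 c] g := by
    have h1 : ∀ᶠ z in 𝓝 c, z ≠ c → φ z = g z := eventually_nhdsWithin_iff.1 hφg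
    filter_upwards [h1] with z hz
    by_cases hzc : z = c
    · simp [hψ, hzc]
    · rw [hψ, Function.update_of_ne hzc, hz hzc]
  have hψd : DifferentiableOn ℂ ψ (Metric.ball c R') := by
    intro z hz
    by_cases hzc : z = c
    · rw [hzc]
      exact (hg.congr hψg.symm).differentiableAt.differentiableWithinAt
    · have hmem : Metric.ball c R' \ {c} ∈ 𝓝 z :=
        (Metric.isOpen_ball.sdiff isClosed_singleton).mem_nhds ⟨hz, hzc⟩
      have h1 : DifferentiableAt ℂ φ z := (hd z ⟨hz, hzc⟩).differentiableAt hmem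
      refine (h1.congr_of_eventuallyEq ?_).differentiableWithinAt
      filter_upwards [isOpen_ne.mem_nhds hzc] with t ht
      rw [hψ, Function.update_of_ne ht]
  have hsub : Metric.closedBall c R ⊆ Metric.ball c R' := Metric.closedBall_subset_ball hRR'
  have h := Complex.norm_le_of_forall_mem_frontier_norm_le (U := Metric.ball c R) (f := ψ) (C := C)
    Metric.isBounded_ball
    (DifferentiableOn.diffContOnCl (by
      rw [closure_ball c hR.ne']
      exact hψd.mono hsub))
    (by
      rw [frontier_ball c hR.ne']
      intro z hz
      have hzc : z ≠ c := by
        rintro rfl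
        simp at hz
        exact hR.ne hz
      rw [hψ, Function.update_of_ne hzc]
      exact hC z hz)
    (z := w) (by rwa [closure_ball c hR.ne'])
  rwa [hψ, Function.update_of_ne hwc] at h

/-- A sequence of functions on a disc with a singularity of order at least `n` at the centre which
is small on the boundary circle is small relative to `(w - c) ^ n` on the disc. -/
theorem eventually_norm_le_zpow {d : ℕ → ℂ → ℂ} {c : ℂ} {R R' : ℝ} {n : ℤ} (hR : 0 < R)
    (hRR' : R < R') (hd : ∀ m, DifferentiableOn ℂ (d m) (Metric.ball c R' \ {c}))
    (hm : ∀ m, MeromorphicAt (d m) c) (ho : ∀ m, (n : WithTop ℤ) ≤ meromorphicOrderAt (d m) c)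
    (hu : TendstoUniformlyOn d (fun _ => 0) atTop (Metric.sphere c R)) {ε : ℝ} (hε : 0 < ε) :
    ∀ᶠ m in atTop, ∀ w ∈ Metric.closedBall c R, w ≠ c → ‖d m w‖ ≤ ε * ‖w - c‖ ^ n := by
  have hRn : 0 < R ^ n := zpow_pos hR n
  filter_upwards [Metric.tendstoUniformlyOn_iff.1 hu (ε * R ^ n) (by positivity)]
    with m hmu w hw hwc
  have hwc' : w - c ≠ 0 := sub_ne_zero.2 hwc
  have hmz : MeromorphicAt (fun z : ℂ => (z - c) ^ (-n)) c := by fun_prop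
  have h := norm_le_of_forall_sphere_of_order_nonneg (φ := fun z => (z - c) ^ (-n) * d m z)
    (C := ε) hR hRR' ?_ (hmz.mul (hm m)) ?_ ?_ hw hwc
  · rw [norm_mul, norm_zpow, zpow_neg, inv_mul_le_iff₀ (zpow_pos (norm_pos_iff.2 hwc') n)] at h
    rwa [mul_comm]
  · intro z hz
    have hzc : z - c ≠ 0 := sub_ne_zero.2 hz.2
    have h1 : DifferentiableWithinAt ℂ (fun z : ℂ => (z - c) ^ (-n))
        (Metric.ball c R' \ {c}) z := by
      refine DifferentiableAt.differentiableWithinAt ?_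
      exact ((differentiableAt_id).sub_const c).zpow (Or.inl hzc)
    exact h1.mul (hd m z hz)
  · rw [fun_meromorphicOrderAt_mul hmz (hm m), fun_meromorphicOrderAt_zpow_id_sub_const]
    calc (0 : WithTop ℤ) = ((-n : ℤ) : WithTop ℤ) + (n : WithTop ℤ) := by
          rw [← WithTop.coe_add]; simp
      _ ≤ _ := by gcongr; exact ho m
  · intro z hz
    have h1 := hmu z hz
    rw [dist_zero_left] at h1
    rw [norm_mul, norm_zpow, mem_sphere_iff_norm.1 hz, zpow_neg, inv_mul_le_iff₀ hRn]
    linarith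

/-- A primitive of a meromorphic function on a punctured disc is meromorphic. -/
theorem meromorphicAt_of_hasDerivAt {g d : ℂ → ℂ} {c : ℂ} {R : ℝ} (hR : 0 < R)
    (hg : ∀ w ∈ Metric.ball c R, w ≠ c → HasDerivAt g (d w) w) (hd : MeromorphicAt d c) :
    MeromorphicAt g c := by
  obtain ⟨k, hk⟩ := hd
  have hb : ∃ C, ∀ᶠ z in 𝓝 c, ‖(z - c) ^ k • d z‖ ≤ C := by
    refine ⟨‖(c - c) ^ k • d c‖ + 1, ?_⟩
    filter_upwards [hk.continuousAt.norm.eventually (gt_mem_nhds (lt_add_one _))] with z hz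
      using hz.le
  obtain ⟨C, hC⟩ := hb
  obtain ⟨r₀, hr₀, hC⟩ := Metric.eventually_nhds_iff.1 hC
  set r := min r₀ R / 2 with hr
  have hr0 : 0 < r := by positivity
  have hrr : r < r₀ := by
    have := min_le_left r₀ R
    linarith
  have hrR : r < R := by
    have := min_le_right r₀ R
    linarith
  have hC0 : 0 ≤ C := (norm_nonneg _).trans (hC (y := c) (by simpa using hr₀))
  have hdiff : ∀ w ∈ Metric.ball c R, w ≠ c → DifferentiableAt ℂ g w := fun w hw hwc =>
    (hg w hw hwc).differentiableAt
  have hcompact : ContinuousOn g (Metric.sphere c r) := by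
    intro w hw
    refine (hdiff w (Metric.sphere_subset_closedBall.trans
      (Metric.closedBall_subset_ball hrR) hw) ?_).continuousAt.continuousWithinAt
    rintro rfl
    simp at hw
    exact hr0.ne hw
  obtain ⟨M, hM⟩ := (isCompact_sphere c r).exists_bound_of_continuousOn hcompact
  -- radial integration from the circle of radius `r` loses no more than one power
  have hest : ∀ w ∈ Metric.ball c r, w ≠ c → ‖(w - c) ^ k * g w‖ ≤ C * r + r ^ k * M := by
    intro w hw hwc
    rw [mem_ball_iff_norm] at hw
    have hw0 : 0 < ‖w - c‖ := norm_pos_iff.2 (sub_ne_zero.2 hwc)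
    set q : ℝ := r / ‖w - c‖ with hq
    have hq1 : 1 ≤ q := by
      rw [hq, one_le_div hw0]
      exact hw.le
    set w₁ : ℂ := c + (q : ℂ) * (w - c) with hw₁
    have hseg : ∀ t ∈ segment ℝ w w₁, ‖w - c‖ ≤ ‖t - c‖ ∧ ‖t - c‖ ≤ r := by
      rintro t ⟨u, v, hu, hv, huv, rfl⟩
      have h1 : u • w + v • w₁ - c = ((u + v * q : ℝ) : ℂ) * (w - c) := by
        have hu' : (u : ℂ) = 1 - v := by
          rw [eq_sub_iff_add_eq]
          exact_mod_cast huv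
        rw [hw₁, Complex.real_smul, Complex.real_smul]
        push_cast
        rw [hu']
        ring
      have h2 : 1 ≤ u + v * q := by nlinarith
      have h3 : u + v * q ≤ q := by nlinarith
      rw [h1, norm_mul, Complex.norm_real, Real.norm_of_nonneg (by linarith)]
      refine ⟨by nlinarith, ?_⟩
      calc (u + v * q) * ‖w - c‖ ≤ q * ‖w - c‖ := by gcongr
        _ = r := by rw [hq]; field_simp
    have hder : ∀ t ∈ segment ℝ w w₁, HasDerivWithinAt g (d t) (segment ℝ w w₁) t := by
      intro t ht
      obtain ⟨h1, h2⟩ := hseg t ht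
      refine (hg t (mem_ball_iff_norm.2 (h2.trans_lt hrR)) ?_).hasDerivWithinAt
      rintro rfl
      simp only [sub_self, norm_zero] at h1
      linarith
    have hbd : ∀ t ∈ segment ℝ w w₁, ‖d t‖ ≤ C / ‖w - c‖ ^ k := by
      intro t ht
      obtain ⟨h1, h2⟩ := hseg t ht
      have h3 := hC (y := t) (by rw [dist_eq_norm]; exact h2.trans_lt hrr)
      rw [norm_smul, norm_pow] at h3
      rw [le_div_iff₀ (by positivity)]
      calc ‖d t‖ * ‖w - c‖ ^ k ≤ ‖d t‖ * ‖t - c‖ ^ k := by gcongr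
        _ ≤ C := by rwa [mul_comm]
    have h4 := (convex_segment w w₁).norm_image_sub_le_of_norm_hasDerivWithin_le hder hbd
      (right_mem_segment ℝ w w₁) (left_mem_segment ℝ w w₁)
    have h5 : ‖w - w₁‖ ≤ r := by
      have : w - w₁ = -(((q - 1 : ℝ) : ℂ) * (w - c)) := by
        rw [hw₁]
        push_cast
        ring
      rw [this, norm_neg, norm_mul, Complex.norm_real, Real.norm_of_nonneg (by linarith)]
      have : q * ‖w - c‖ = r := by rw [hq]; field_simp
      nlinarith
    have h6 : ‖g w₁‖ ≤ M := by
      refine hM w₁ ?_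
      rw [mem_sphere_iff_norm, hw₁, add_sub_cancel_left, norm_mul, Complex.norm_real,
        Real.norm_of_nonneg (by linarith), hq]
      field_simp
    have h7 : ‖g w‖ ≤ ‖g w - g w₁‖ + ‖g w₁‖ := norm_le_norm_sub_add _ _
    have hk0 : 0 < ‖w - c‖ ^ k := by positivity
    have h8 : ‖w - c‖ ^ k * (C / ‖w - c‖ ^ k * ‖w - w₁‖) ≤ C * r := by
      calc _ = C * ‖w - w₁‖ := by field_simp
        _ ≤ C * r := by gcongr
    have hM0 : 0 ≤ M := (norm_nonneg _).trans h6
    rw [norm_mul, norm_pow]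
    calc ‖w - c‖ ^ k * ‖g w‖ ≤ ‖w - c‖ ^ k * (C / ‖w - c‖ ^ k * ‖w - w₁‖ + M) := by
          gcongr
          linarith
      _ = ‖w - c‖ ^ k * (C / ‖w - c‖ ^ k * ‖w - w₁‖) + ‖w - c‖ ^ k * M := by ring
      _ ≤ C * r + r ^ k * M := by gcongr
  refine ⟨k + 1, ?_⟩
  have hpd : ∀ᶠ z in 𝓝[≠] c, DifferentiableAt ℂ (fun z => (z - c) ^ (k + 1) • g z) z := by
    filter_upwards [nhdsWithin_le_nhds (Metric.ball_mem_nhds c hR), self_mem_nhdsWithin]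
      with z hz hzc
    exact (((differentiableAt_id).sub_const c).pow (k + 1)).smul (hdiff z hz hzc)
  refine Complex.analyticAt_of_differentiable_on_punctured_nhds_of_continuousAt hpd ?_
  have h0 : Tendsto (fun z : ℂ => ‖z - c‖ * (C * r + r ^ k * M)) (𝓝 c) (𝓝 0) := by
    have : ContinuousAt (fun z : ℂ => ‖z - c‖ * (C * r + r ^ k * M)) c := by fun_prop
    simpa [ContinuousAt] using this
  rw [ContinuousAt, sub_self, pow_succ, mul_zero, zero_smul, tendsto_zero_iff_norm_tendsto_zero]
  refine squeeze_zero' (Eventually.of_forall fun z => norm_nonneg _) ?_ h0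
  filter_upwards [Metric.ball_mem_nhds c hr0] with z hz
  by_cases hzc : z = c
  · simp [hzc]
  · have := hest z hz hzc
    rw [smul_eq_mul, pow_succ', mul_assoc, norm_mul]
    gcongr

/-- Integration raises the order of a singularity by one, provided the constant of integration is
zero at a regular point. -/
theorem succ_le_meromorphicOrderAt_of_hasDerivAt {g d : ℂ → ℂ} {c : ℂ} {R : ℝ} {n : ℤ} (hR : 0 < R)
    (hg : ∀ w ∈ Metric.ball c R, w ≠ c → HasDerivAt g (d w) w)
    (hn : (n : WithTop ℤ) ≤ meromorphicOrderAt d c)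
    (h0 : 0 ≤ n → AnalyticAt ℂ g c ∧ g c = 0) :
    ((n + 1 : ℤ) : WithTop ℤ) ≤ meromorphicOrderAt g c := by
  have hdd : deriv g =ᶠ[𝓝[≠] c] d := by
    filter_upwards [nhdsWithin_le_nhds (Metric.ball_mem_nhds c hR), self_mem_nhdsWithin]
      with z hz hzc
    exact (hg z hz hzc).deriv
  rw [← meromorphicOrderAt_congr hdd] at hn
  rcases hj : meromorphicOrderAt g c with _ | j
  · exact le_top
  change meromorphicOrderAt g c = (j : WithTop ℤ) at hj
  by_cases hj0 : j = 0
  · have hn0 : ¬ 0 ≤ n := by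
      intro hn0
      obtain ⟨h1, h2⟩ := h0 hn0
      have := (h1.meromorphicNFAt.meromorphicOrderAt_eq_zero_iff).1 (by rw [hj, hj0]; rfl)
      exact this h2
    change ((n + 1 : ℤ) : WithTop ℤ) ≤ (j : WithTop ℤ)
    exact_mod_cast (by omega : n + 1 ≤ j)
  · rw [meromorphicOrderAt_deriv_eq_sub_one (by exact_mod_cast hj0) hj] at hn
    have : n ≤ j - 1 := by exact_mod_cast hn
    change ((n + 1 : ℤ) : WithTop ℤ) ≤ (j : WithTop ℤ)
    exact_mod_cast (by omega : n + 1 ≤ j)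

/-- A meromorphic function of order `n` is close to a monomial near the singularity. -/
theorem exists_norm_sub_le_of_meromorphicOrderAt_eq {a : ℂ → ℂ} {c : ℂ} {n : ℤ}
    (hm : MeromorphicAt a c) (ho : meromorphicOrderAt a c = n) {ε : ℝ} (hε : 0 < ε) :
    ∃ α : ℂ, α ≠ 0 ∧ ∀ᶠ w in 𝓝[≠] c, ‖a w - α * (w - c) ^ n‖ ≤ ε * ‖α * (w - c) ^ n‖ := by
  obtain ⟨A, hA, hA0, hAa⟩ := (meromorphicOrderAt_eq_int_iff hm).1 ho
  refine ⟨A c, hA0, ?_⟩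
  have h1 : ∀ᶠ w in 𝓝 c, ‖A w - A c‖ ≤ ε * ‖A c‖ := by
    have : Tendsto (fun w => ‖A w - A c‖) (𝓝 c) (𝓝 0) := by
      have := (hA.continuousAt.tendsto.sub_const (A c)).norm
      simpa using this
    filter_upwards [this.eventually (gt_mem_nhds (show 0 < ε * ‖A c‖ by positivity))] with w hw
      using hw.le
  filter_upwards [hAa, nhdsWithin_le_nhds h1] with w hw1 hw2
  rw [hw1, smul_eq_mul, mul_comm, ← sub_mul, norm_mul, norm_mul, ← mul_assoc]
  gcongr

end RiemannSurface

namespace RiemannSurface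

/-! ### One-forms in charts -/

theorem eventually_mem_target_and_symm_mem {X : Type*} [TopologicalSpace X]
    {e : OpenPartialHomeomorph X ℂ} {z : ℂ} (hz : z ∈ e.target) {s : Set X} (hs : IsOpen s)
    (hzs : e.symm z ∈ s) :
    ∀ᶠ t in 𝓝 z, t ∈ e.target ∧ e.symm t ∈ s :=
  (e.open_target.eventually_mem hz).and
    ((e.continuousAt_symm hz).eventually (hs.eventually_mem hzs))

theorem clm_comp_apply_eq_mul (A B : ℂ →L[ℂ] ℂ) (d : ℂ) : A (B d) = A (B 1) * d := by
  have h := (A.comp B).map_smul d 1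
  rw [smul_eq_mul, smul_eq_mul, mul_one, mul_comm] at h
  exact h

theorem clm_ext_of_ne_zero {A B : ℂ →L[ℂ] ℂ} {v : ℂ} (hv : v ≠ 0) (h : A v = B v) : A = B := by
  refine ContinuousLinearMap.ext fun u => ?_
  have h1 : u = (u / v) • v := by
    rw [smul_eq_mul]
    field_simp
  rw [h1, ContinuousLinearMap.map_smul, ContinuousLinearMap.map_smul, h]

variable {X : Type*} [TopologicalSpace X] [ChartedSpace ℂ X] [IsManifold 𝓘(ℂ, ℂ) ω X]

theorem mdifferentiableAt_chart {e : OpenPartialHomeomorph X ℂ} (he : e ∈ atlas ℂ X) {x : X}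
    (hx : x ∈ e.source) : MDifferentiableAt 𝓘(ℂ, ℂ) 𝓘(ℂ, ℂ) e x := by
  have : IsManifold 𝓘(ℂ, ℂ) 1 X := IsManifold.of_le (n := ω) le_top
  exact mdifferentiableAt_atlas he hx

theorem mdifferentiableAt_chart_symm {e : OpenPartialHomeomorph X ℂ} (he : e ∈ atlas ℂ X) {z : ℂ}
    (hz : z ∈ e.target) : MDifferentiableAt 𝓘(ℂ, ℂ) 𝓘(ℂ, ℂ) e.symm z := by
  have : IsManifold 𝓘(ℂ, ℂ) 1 X := IsManifold.of_le (n := ω) le_top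
  exact mdifferentiableAt_atlas_symm he hz

theorem differentiableAt_transition {e e' : OpenPartialHomeomorph X ℂ} (he : e ∈ atlas ℂ X)
    (he' : e' ∈ atlas ℂ X) {z : ℂ} (hz : z ∈ e.target) (hz' : e.symm z ∈ e'.source) :
    DifferentiableAt ℂ (e' ∘ e.symm) z :=
  mdifferentiableAt_iff_differentiableAt.1
    ((mdifferentiableAt_chart he' hz').comp z (mdifferentiableAt_chart_symm he hz))

/-- Change of charts. -/
theorem coeff_eq_coeff_mul_deriv (α : Form X) {e e' : OpenPartialHomeomorph X ℂ}
    (he : e ∈ atlas ℂ X) (he' : e' ∈ atlas ℂ X) {z : ℂ} (hz : z ∈ e.target)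
    (hz' : e.symm z ∈ e'.source) :
    coeff α e z = coeff α e' (e' (e.symm z)) * deriv (e' ∘ e.symm) z := by
  set φ : ℂ → ℂ := e' ∘ e.symm with hφ
  have h1 : HasMFDerivAt 𝓘(ℂ, ℂ) 𝓘(ℂ, ℂ) φ z (fderiv ℂ φ z) :=
    (differentiableAt_transition he he' hz hz').hasFDerivAt.hasMFDerivAt
  have hφz : φ z ∈ e'.target := e'.map_source hz'
  have h2 := (mdifferentiableAt_chart_symm he' hφz).hasMFDerivAt.comp z h1
  have h3 : e.symm =ᶠ[𝓝 z] e'.symm ∘ φ := by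
    filter_upwards [eventually_mem_target_and_symm_mem hz e'.open_source hz'] with t ht
    exact (e'.left_inv ht.2).symm
  have h4 := (h2.congr_of_eventuallyEq h3).mfderiv
  have h5 : e'.symm (φ z) = e.symm z := e'.left_inv hz'
  unfold coeff
  rw [h4]
  change (α (e.symm z) : ℂ →L[ℂ] ℂ) ((mfderiv 𝓘(ℂ, ℂ) 𝓘(ℂ, ℂ) e'.symm (φ z) : ℂ →L[ℂ] ℂ)
    (fderiv ℂ φ z (1 : ℂ))) = (α (e'.symm (φ z)) : ℂ →L[ℂ] ℂ)
      ((mfderiv 𝓘(ℂ, ℂ) 𝓘(ℂ, ℂ) e'.symm (φ z) : ℂ →L[ℂ] ℂ) (1 : ℂ)) * deriv φ z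
  rw [h5, fderiv_apply_one_eq_deriv]
  exact clm_comp_apply_eq_mul _ _ _

theorem mfderiv_chart_symm_one_ne_zero {e : OpenPartialHomeomorph X ℂ} (he : e ∈ atlas ℂ X) {z : ℂ}
    (hz : z ∈ e.target) : (mfderiv 𝓘(ℂ, ℂ) 𝓘(ℂ, ℂ) e.symm z : ℂ →L[ℂ] ℂ) (1 : ℂ) ≠ 0 := by
  intro h0
  have h1 := (mdifferentiableAt_chart he (e.map_target hz)).hasMFDerivAt.comp z
    (mdifferentiableAt_chart_symm he hz).hasMFDerivAt
  have h2 : id =ᶠ[𝓝 z] e ∘ e.symm := by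
    filter_upwards [e.open_target.mem_nhds hz] with t ht
    exact (e.right_inv ht).symm
  have h3 := (h1.congr_of_eventuallyEq h2).mfderiv
  rw [mfderiv_id] at h3
  have h4 : (1 : ℂ) = (mfderiv 𝓘(ℂ, ℂ) 𝓘(ℂ, ℂ) e (e.symm z) : ℂ →L[ℂ] ℂ)
      ((mfderiv 𝓘(ℂ, ℂ) 𝓘(ℂ, ℂ) e.symm z : ℂ →L[ℂ] ℂ) (1 : ℂ)) :=
    congrArg (fun L : ℂ →L[ℂ] ℂ => L (1 : ℂ)) h3
  rw [h0, map_zero] at h4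
  exact one_ne_zero (α := ℂ) h4

theorem coeff_eq_zero_iff (α : Form X) {e : OpenPartialHomeomorph X ℂ} (he : e ∈ atlas ℂ X) {z : ℂ}
    (hz : z ∈ e.target) : coeff α e z = 0 ↔ α (e.symm z) = 0 := by
  constructor
  · intro h
    exact clm_ext_of_ne_zero (mfderiv_chart_symm_one_ne_zero he hz) h
  · intro h
    unfold coeff
    rw [h]
    rfl

namespace MeromorphicForm

variable {W : Set X}

/-- The normalisation makes the zeros and poles exactly the points where the form takes the
value `0`. -/
theorem apply_eq_zero_iff (α : MeromorphicForm W) {x : X} (hx : x ∈ W) :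
    α.toFun x = 0 ↔ x ∈ α.zeros ∪ α.poles := by
  have h1 := (α.meromorphic x hx).meromorphicOrderAt_eq_zero_iff
  have h2 := coeff_eq_zero_iff α.toFun (chart_mem_atlas ℂ x) (mem_chart_target ℂ x)
  rw [(chartAt ℂ x).left_inv (mem_chart_source ℂ x)] at h2
  rw [← h2, ← not_iff_not, ← ne_eq, ← h1]
  constructor
  · rintro h (h3 | h3)
    · exact h3.2.ne' h
    · exact h3.2.ne h
  · intro h
    rcases lt_trichotomy (α.ord x) 0 with h3 | h3 | h3
    · exact absurd (Or.inr ⟨hx, h3⟩) h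
    · exact h3
    · exact absurd (Or.inl ⟨hx, h3⟩) h

theorem analyticAt_coeff (α : MeromorphicForm W) {e : OpenPartialHomeomorph X ℂ}
    (he : e ∈ atlas ℂ X) {z : ℂ} (hz : z ∈ e.target) (hW : e.symm z ∈ W)
    (hp : e.symm z ∉ α.poles) : AnalyticAt ℂ (coeff α.toFun e) z := by
  set e' := chartAt ℂ (e.symm z) with he'
  have hz' : e.symm z ∈ e'.source := mem_chart_source ℂ _
  have hev := eventually_mem_target_and_symm_mem hz e'.open_source hz'
  have hφ : AnalyticAt ℂ (e' ∘ e.symm) z :=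
    Complex.analyticAt_iff_eventually_differentiableAt.2 (hev.mono fun t ht =>
      differentiableAt_transition he (chart_mem_atlas ℂ _) ht.1 ht.2)
  have h1 : AnalyticAt ℂ (coeff α.toFun e') ((e' ∘ e.symm) z) :=
    α.analyticAt_of_not_mem_poles hW hp
  refine ((h1.comp hφ).mul hφ.deriv).congr ?_
  filter_upwards [hev] with t ht
  exact (coeff_eq_coeff_mul_deriv α.toFun he (chart_mem_atlas ℂ _) ht.1 ht.2).symm

end MeromorphicForm

/-- A function whose real differential is the real form underlying `α` is, in a chart,
a holomorphic primitive of the coefficient function of `α`. -/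
theorem hasDerivAt_comp_chart_symm {f : X → ℂ} {α : Form X} {e : OpenPartialHomeomorph X ℂ}
    (he : e ∈ atlas ℂ X) {z : ℂ} (hz : z ∈ e.target)
    (hf : HasMFDerivAt 𝓘(ℝ, ℂ) 𝓘(ℝ, ℂ) f (e.symm z) (Form.toReal α (e.symm z))) :
    HasDerivAt (f ∘ e.symm) (coeff α e z) z := by
  have h1 := (mdifferentiableAt_chart_symm he hz).hasMFDerivAt
  have h2 : HasMFDerivAt 𝓘(ℝ, ℂ) 𝓘(ℝ, ℂ) e.symm z
      ((mfderiv 𝓘(ℂ, ℂ) 𝓘(ℂ, ℂ) e.symm z : ℂ →L[ℂ] ℂ).restrictScalars ℝ : ℂ →L[ℝ] ℂ) :=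
    ⟨h1.1, h1.2.restrictScalars ℝ⟩
  have h3 := hasMFDerivAt_iff_hasFDerivAt.1 (hf.comp z h2)
  have h4 : HasFDerivAt (f ∘ e.symm) ((α (e.symm z) : ℂ →L[ℂ] ℂ).comp
      (mfderiv 𝓘(ℂ, ℂ) 𝓘(ℂ, ℂ) e.symm z : ℂ →L[ℂ] ℂ)) z := by
    refine HasFDerivAt.of_isLittleO ?_
    exact h3.isLittleO
  exact h4.hasDerivAt

/-- A self-map that in a chart is given by a holomorphic function `k` is holomorphic, and its effect
on one-forms can be computed in the chart. -/
theorem mdifferentiableAt_and_pullback {h : X → X} {k : ℂ → ℂ} {e : OpenPartialHomeomorph X ℂ}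
    (he : e ∈ atlas ℂ X) {w d : ℂ} (hw : w ∈ e.target) (hkw : k w ∈ e.target)
    (hk : HasDerivAt k d w) (hh : ∀ᶠ t in 𝓝 w, h (e.symm t) = e.symm (k t)) :
    MDifferentiableAt 𝓘(ℂ, ℂ) 𝓘(ℂ, ℂ) h (e.symm w) ∧ ∀ α β : Form X,
      coeff α e (k w) * d = coeff β e w → pullback h α (e.symm w) = β (e.symm w) := by
  have hsrc := e.map_target hw
  have hmd : MDifferentiableAt 𝓘(ℂ, ℂ) 𝓘(ℂ, ℂ) h (e.symm w) := by
    have h1 : MDifferentiableAt 𝓘(ℂ, ℂ) 𝓘(ℂ, ℂ) (e.symm ∘ k) (e (e.symm w)) := by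
      rw [e.right_inv hw]
      exact (mdifferentiableAt_chart_symm he hkw).comp w hk.differentiableAt.mdifferentiableAt
    refine (h1.comp (e.symm w) (mdifferentiableAt_chart he hsrc)).congr_of_eventuallyEq ?_
    have h2 : ∀ᶠ x in 𝓝 (e.symm w), h (e.symm (e x)) = e.symm (k (e x)) := by
      have h3 := e.continuousAt hsrc
      rw [ContinuousAt, e.right_inv hw] at h3
      exact h3.eventually hh
    filter_upwards [h2, e.open_source.mem_nhds hsrc] with x hx hxs
    rw [e.left_inv hxs] at hx
    exact hx
  refine ⟨hmd, fun α β hαβ => ?_⟩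
  refine clm_ext_of_ne_zero (mfderiv_chart_symm_one_ne_zero he hw) ?_
  have h1 := hmd.hasMFDerivAt.comp w (mdifferentiableAt_chart_symm he hw).hasMFDerivAt
  have h2 := (mdifferentiableAt_chart_symm he hkw).hasMFDerivAt.comp w
    hk.hasFDerivAt.hasMFDerivAt
  have h3 := hasMFDerivAt_unique h1 (h2.congr_of_eventuallyEq (by
    filter_upwards [hh] with t ht using ht))
  have h4 : (mfderiv 𝓘(ℂ, ℂ) 𝓘(ℂ, ℂ) h (e.symm w) : ℂ →L[ℂ] ℂ)
      ((mfderiv 𝓘(ℂ, ℂ) 𝓘(ℂ, ℂ) e.symm w : ℂ →L[ℂ] ℂ) (1 : ℂ)) =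
      (mfderiv 𝓘(ℂ, ℂ) 𝓘(ℂ, ℂ) e.symm (k w) : ℂ →L[ℂ] ℂ) d := by
    have := congrArg (fun L : ℂ →L[ℂ] ℂ => L (1 : ℂ)) h3
    refine this.trans ?_
    change (mfderiv 𝓘(ℂ, ℂ) 𝓘(ℂ, ℂ) e.symm (k w) : ℂ →L[ℂ] ℂ) _ = _
    congr 1
    change (1 : ℂ) * d = d
    rw [one_mul]
  have h5 : ∀ y, y = e.symm (k w) → ∀ v : ℂ,
      (α y : ℂ →L[ℂ] ℂ) v = (α (e.symm (k w)) : ℂ →L[ℂ] ℂ) v := by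
    rintro _ rfl v
    rfl
  calc _ = (α (h (e.symm w)) : ℂ →L[ℂ] ℂ)
        ((mfderiv 𝓘(ℂ, ℂ) 𝓘(ℂ, ℂ) e.symm (k w) : ℂ →L[ℂ] ℂ) d) :=
        congrArg (fun v : ℂ => (α (h (e.symm w)) : ℂ →L[ℂ] ℂ) v) h4
    _ = (α (e.symm (k w)) : ℂ →L[ℂ] ℂ)
        ((mfderiv 𝓘(ℂ, ℂ) 𝓘(ℂ, ℂ) e.symm (k w) : ℂ →L[ℂ] ℂ) d) := h5 _ hh.self_of_nhds _
    _ = coeff α e (k w) * d := clm_comp_apply_eq_mul _ _ _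
    _ = coeff β e w := hαβ

end RiemannSurface

namespace RiemannSurface

/-! ### Primitives of a sequence of exact forms that tends to zero -/

/-- A function whose differential is small on a ball oscillates little there. -/
theorem eventually_norm_sub_le_of_tendstoUniformlyOn {f d : ℕ → ℂ → ℂ} {c : ℂ} {r : ℝ}
    (hr : 0 < r) (hf : ∀ m, ∀ t ∈ Metric.closedBall c r, HasDerivAt (f m) (d m t) t)
    (hd : TendstoUniformlyOn d (fun _ => 0) atTop (Metric.closedBall c r)) {ε : ℝ} (hε : 0 < ε) :
    ∀ᶠ m in atTop, ∀ t ∈ Metric.closedBall c r, ∀ u ∈ Metric.closedBall c r,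
      ‖f m t - f m u‖ ≤ ε := by
  filter_upwards [Metric.tendstoUniformlyOn_iff.1 hd (ε / (2 * r)) (by positivity)]
    with m hm t ht u hu
  have h1 : ∀ x ∈ Metric.closedBall c r, ‖d m x‖ ≤ ε / (2 * r) := fun x hx => by
    have := hm x hx
    rw [dist_zero_left] at this
    exact this.le
  have h2 := (convex_closedBall c r).norm_image_sub_le_of_norm_hasDerivWithin_le
    (fun x hx => (hf m x hx).hasDerivWithinAt) h1 hu ht
  have h3 : ‖t - u‖ ≤ 2 * r := by
    rw [Metric.mem_closedBall, dist_eq_norm] at ht hu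
    have := norm_sub_le_norm_sub_add_norm_sub t c u
    rw [norm_sub_rev c u] at this
    linarith
  calc ‖f m t - f m u‖ ≤ ε / (2 * r) * ‖t - u‖ := h2
    _ ≤ ε / (2 * r) * (2 * r) := by gcongr
    _ = ε := by field_simp

theorem exists_closedBall_subset_target {X : Type*} [TopologicalSpace X]
    {e : OpenPartialHomeomorph X ℂ} {z : ℂ} (hz : z ∈ e.target) {s : Set X} (hs : IsOpen s)
    (hzs : e.symm z ∈ s) :
    ∃ r > 0, Metric.closedBall z r ⊆ e.target ∩ e.symm ⁻¹' s :=
  Metric.nhds_basis_closedBall.mem_iff.1 (eventually_mem_target_and_symm_mem hz hs hzs)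

variable {X : Type*} [TopologicalSpace X] [ChartedSpace ℂ X]

variable [IsManifold 𝓘(ℂ, ℂ) ω X]

/-- If exact forms `δ m = df` with `f = 0` on `Z` tend to zero uniformly on compact sets, then the
primitives can be chosen so as to vanish on `Z` and to tend to zero uniformly on compact sets. The
primitives given by exactness only have to be corrected by a constant on those components of `M`
that do not meet `Z`. -/
theorem exists_primitives_tendsto_zero {M Z : Set X} (hM : IsOpen M) (hZM : Z ⊆ M)
    {δ : ℕ → Form X}
    (hδ : ∀ e ∈ atlas ℂ X, ∀ K ⊆ e.target ∩ e.symm ⁻¹' M, IsCompact K →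
      TendstoUniformlyOn (fun m => coeff (δ m) e) (fun _ => 0) atTop K)
    (hex : ∀ m, ∃ f : X → ℂ, (∀ x ∈ Z, f x = 0) ∧
      ∀ x ∈ M, HasMFDerivAt 𝓘(ℝ, ℂ) 𝓘(ℝ, ℂ) f x (Form.toReal (δ m) x)) :
    ∃ g : ℕ → X → ℂ, (∀ m, ∀ x ∈ Z, g m x = 0) ∧
      (∀ m, ∀ e ∈ atlas ℂ X, ∀ z ∈ e.target, e.symm z ∈ M →
        HasDerivAt (g m ∘ e.symm) (coeff (δ m) e z) z) ∧
      ∀ e ∈ atlas ℂ X, ∀ K ⊆ e.target ∩ e.symm ⁻¹' M, IsCompact K →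
        TendstoUniformlyOn (fun m => g m ∘ e.symm) (fun _ => 0) atTop K := by
  classical
  have : LocallyConnectedSpace X := ChartedSpace.locallyConnectedSpace ℂ X
  choose f hfZ hf using hex
  have hosc : ∀ e ∈ atlas ℂ X, ∀ z ∈ e.target, e.symm z ∈ M → ∃ r > 0,
      Metric.closedBall z r ⊆ e.target ∩ e.symm ⁻¹' M ∧ ∀ ε > 0, ∀ᶠ m in atTop,
        ∀ t ∈ Metric.closedBall z r, ‖f m (e.symm t) - f m (e.symm z)‖ ≤ ε := by
    intro e he z hz hzM
    obtain ⟨r, hr, hrs⟩ := exists_closedBall_subset_target hz hM hzM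
    refine ⟨r, hr, hrs, fun ε hε => ?_⟩
    have h1 := eventually_norm_sub_le_of_tendstoUniformlyOn (f := fun m => f m ∘ e.symm) hr
      (fun m t ht => hasDerivAt_comp_chart_symm he (hrs ht).1 (hf m _ (hrs ht).2))
      (hδ e he _ hrs (isCompact_closedBall z r)) hε
    filter_upwards [h1] with m hm t ht
    exact hm t ht z (Metric.mem_closedBall_self hr.le)
  have hpair : ∀ C ⊆ M, IsPreconnected C → ∀ x ∈ C, ∀ y ∈ C,
      Tendsto (fun m => f m x - f m y) atTop (𝓝 0) := by
    intro C hCM hC x hx y hy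
    refine hC.induction₂ (fun x y => Tendsto (fun m => f m x - f m y) atTop (𝓝 0))
      ?_ ?_ ?_ hx hy
    · intro x hx
      refine nhdsWithin_le_nhds ?_
      have hxs := mem_chart_source ℂ x
      have hxt := mem_chart_target ℂ x
      obtain ⟨r, hr, -, h1⟩ := hosc _ (chart_mem_atlas ℂ x) _ hxt
        (by rw [(chartAt ℂ x).left_inv hxs]; exact hCM hx)
      filter_upwards [(chartAt ℂ x).open_source.mem_nhds hxs,
        ((chartAt ℂ x).continuousAt hxs).eventually (Metric.closedBall_mem_nhds _ hr)]
        with y hy1 hy2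
      rw [Metric.tendsto_nhds]
      intro ε hε
      filter_upwards [h1 (ε / 2) (half_pos hε)] with m hm
      have := hm _ hy2
      rw [(chartAt ℂ x).left_inv hy1, (chartAt ℂ x).left_inv hxs] at this
      rw [dist_zero_right, norm_sub_rev]
      linarith
    · intro x y z _ _ _ h1 h2
      simpa using h1.add h2
    · intro x y _ _ h1
      simpa using h1.neg
  -- the base point of a component
  set b : Set X → X → X := fun C x =>
    if h : (C ∩ Z).Nonempty then h.some else if h' : C.Nonempty then h'.some else x with hb
  have hb_const : ∀ C : Set X, C.Nonempty → ∀ x y, b C x = b C y := by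
    intro C hC x y
    simp only [hb]
    split_ifs <;> rfl
  have hb_mem : ∀ C : Set X, C.Nonempty → ∀ x, b C x ∈ C := by
    intro C hC x
    simp only [hb]
    split_ifs with h
    · exact h.some_mem.1
    · exact hC.some_mem
  have hb_Z : ∀ C : Set X, (C ∩ Z).Nonempty → ∀ x, b C x ∈ Z := by
    intro C hC x
    simp only [hb, dif_pos hC]
    exact hC.some_mem.2
  set g : ℕ → X → ℂ := fun m x => f m x - f m (b (connectedComponentIn M x) x) with hg
  have hself : ∀ x ∈ M, x ∈ connectedComponentIn M x := fun x hx => mem_connectedComponentIn hx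
  have hgloc : ∀ x ∈ M, ∀ᶠ y in 𝓝 x, ∀ m, g m y = f m y - f m (b (connectedComponentIn M x) x) := by
    intro x hx
    filter_upwards [(hM.connectedComponentIn).mem_nhds (hself x hx)] with y hy m
    simp only [hg]
    rw [← connectedComponentIn_eq hy, hb_const _ ⟨y, hy⟩ y x]
  have hgt : ∀ x ∈ M, Tendsto (fun m => g m x) atTop (𝓝 0) := by
    intro x hx
    exact hpair _ (connectedComponentIn_subset M x) isPreconnected_connectedComponentIn _
      (hself x hx) _ (hb_mem _ ⟨x, hself x hx⟩ x)
  refine ⟨g, ?_, ?_, ?_⟩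
  · intro m x hx
    simp only [hg]
    rw [hfZ m x hx, hfZ m _ (hb_Z _ ⟨x, hself x (hZM hx), hx⟩ x), sub_zero]
  · intro m e he z hz hzM
    have h1 := (hasDerivAt_comp_chart_symm he hz (hf m _ hzM)).sub_const
      (f m (b (connectedComponentIn M (e.symm z)) (e.symm z)))
    refine h1.congr_of_eventuallyEq ?_
    filter_upwards [(e.continuousAt_symm hz).eventually (hgloc _ hzM)] with t ht using ht m
  · intro e he K hK hKc
    rw [← tendstoLocallyUniformlyOn_iff_tendstoUniformlyOn_of_compact hKc,
      Metric.tendstoLocallyUniformlyOn_iff]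
    intro ε hε z hz
    obtain ⟨r, hr, hrs, h1⟩ := hosc e he z (hK hz).1 (hK hz).2
    have h2 := (e.continuousAt_symm (hK hz).1).eventually (hgloc _ (hK hz).2)
    refine ⟨{t | t ∈ Metric.closedBall z r ∧ ∀ m, g m (e.symm t) =
      f m (e.symm t) - f m (b (connectedComponentIn M (e.symm z)) (e.symm z))},
      nhdsWithin_le_nhds (inter_mem (Metric.closedBall_mem_nhds z hr) h2), ?_⟩
    filter_upwards [h1 (ε / 2) (half_pos hε), (Metric.tendsto_nhds.1 (hgt _ (hK hz).2)) (ε / 2)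
      (half_pos hε)] with m hm1 hm2 t ht
    rw [dist_zero_left]
    rw [dist_zero_right] at hm2
    have h3 : g m (e.symm t) = (f m (e.symm t) - f m (e.symm z)) + g m (e.symm z) := by
      rw [ht.2 m]
      simp only [hg]
      ring
    have h4 := norm_add_le (f m (e.symm t) - f m (e.symm z)) (g m (e.symm z))
    rw [← h3] at h4
    have h5 := hm1 t ht.1
    change ‖g m (e.symm t)‖ < ε
    linarith

end RiemannSurface

namespace RiemannSurface

/-! ### Solving the integral equation for a sequence -/

/-- Sequence form of `exists_solution`, on a disc that may contain the singular point `o`. -/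
theorem exists_solution_sequence {a b G : ℕ → ℂ → ℂ} {c o α : ℂ} {n : ℤ} {R : ℝ} (hR : 0 < R)
    (hα : α ≠ 0) (ha : ∀ᶠ m in atTop, NearMonomial (a m) o α n (Metric.ball c R))
    (hda : ∀ m, DifferentiableOn ℂ (a m) (Metric.ball c R \ {o}))
    (hG : ∀ m, ∀ w ∈ Metric.ball c R, w ≠ o → HasDerivAt (G m) (b m w - a m w) w)
    (hGs : ∀ ε > 0, ∀ᶠ m in atTop, ∀ w ∈ Metric.ball c R, w ≠ o →
      ‖G m w‖ ≤ ε * ‖w - o‖ ^ (n + 1)) :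
    ∃ ρ > 0, (∀ w ∈ Metric.ball c (R / 2), Metric.ball w (ρ * ‖w - o‖) ⊆ Metric.ball c R) ∧
      ∃ k : ℕ → ℂ → ℂ, (∀ m, k m o = o) ∧
      (∀ τ > 0, ∀ᶠ m in atTop, ∀ w ∈ Metric.ball c (R / 2), ‖k m w - w‖ ≤ τ * ‖w - o‖) ∧
      (∀ᶠ m in atTop, DifferentiableOn ℂ (k m) (Metric.ball c (R / 2))) ∧
      ∀ᶠ m in atTop, ∀ w ∈ Metric.ball c (R / 2), w ≠ o →
        HasDerivAt (k m) (b m w / a m (k m w)) w ∧ a m (k m w) ≠ 0 ∧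
        ∃ F : ℂ → ℂ, (∀ t ∈ Metric.ball w (ρ * ‖w - o‖), HasDerivAt F (a m t) t) ∧
          InjOn F (Metric.ball w (ρ * ‖w - o‖)) ∧ k m w ∈ Metric.ball w (ρ * ‖w - o‖) ∧
          F (k m w) - F w = G m w := by
  classical
  have hα' := norm_pos_iff.2 hα
  obtain ⟨ρ₀, hρ₀, hρ₀', hn⟩ := exists_norm_one_add_zpow_sub_one_le n
  set L : ℝ := R + ‖c - o‖ with hL
  have hL0 : 0 < L := by positivity
  set ρ : ℝ := min ρ₀ (R / (2 * L)) with hρdef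
  have hρ : 0 < ρ := by positivity
  have hρ1 : ρ ≤ 1 / 2 := (min_le_left _ _).trans hρ₀'
  have hn' : ∀ s : ℂ, ‖s‖ ≤ ρ → ‖(1 + s) ^ n - 1‖ ≤ 1 / 8 := fun s hs =>
    hn s (hs.trans (min_le_left _ _))
  have hsub : Metric.ball c (R / 2) ⊆ Metric.ball c R := Metric.ball_subset_ball (by linarith)
  have hball : ∀ w ∈ Metric.ball c (R / 2), Metric.ball w (ρ * ‖w - o‖) ⊆ Metric.ball c R := by
    intro w hw t ht
    rw [mem_ball_iff_norm] at hw ht ⊢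
    have h1 : ‖w - o‖ ≤ L := by
      have := norm_sub_le_norm_sub_add_norm_sub w c o
      linarith
    have h2 : ρ * ‖w - o‖ ≤ R / (2 * L) * L := by
      gcongr
      exact min_le_right _ _
    have h3 : R / (2 * L) * L = R / 2 := by field_simp
    have := norm_sub_le_norm_sub_add_norm_sub t w c
    linarith
  set good : ℕ → Prop := fun m => NearMonomial (a m) o α n (Metric.ball c R) ∧
    ∀ w ∈ Metric.ball c R, w ≠ o → ‖G m w‖ ≤ ‖α‖ * ρ / 128 * ‖w - o‖ ^ (n + 1) with hgood
  have hgood_ev : ∀ᶠ m in atTop, good m := ha.and (hGs _ (by positivity))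
  have hsol : ∀ m, ∃ h : ℂ → ℂ, h o = o ∧ (good m → ∀ w ∈ Metric.ball c (R / 2), w ≠ o →
      ‖h w - w‖ * ‖α * (w - o) ^ n‖ ≤ 2 * ‖G m w‖ ∧ HasDerivAt h (b m w / a m (h w)) w ∧
      a m (h w) ≠ 0 ∧
      ∃ F : ℂ → ℂ, (∀ t ∈ Metric.ball w (ρ * ‖w - o‖), HasDerivAt F (a m t) t) ∧
        InjOn F (Metric.ball w (ρ * ‖w - o‖)) ∧ h w ∈ Metric.ball w (ρ * ‖w - o‖) ∧
        F (h w) - F w = G m w) := by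
    intro m
    by_cases hm : good m
    · obtain ⟨h, h1, h2⟩ := exists_solution (G := G m) (b := b m) hα Metric.isOpen_ball hm.1 hρ hρ1
        hn' (hda m) hball (fun w hw => hG m w (hsub hw)) (fun w hw hwo => by
          have hwo' := norm_pos_iff.2 (sub_ne_zero.2 hwo)
          have h3 := hm.2 w (hsub hw) hwo
          rw [zpow_add_one₀ hwo'.ne'] at h3
          rw [norm_mul, norm_zpow]
          have h4 : 0 < ‖α‖ * ρ * (‖w - o‖ ^ n * ‖w - o‖) := by positivity
          calc ‖G m w‖ ≤ ‖α‖ * ρ / 128 * (‖w - o‖ ^ n * ‖w - o‖) := h3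
            _ < ‖α‖ * ‖w - o‖ ^ n / 64 * (ρ * ‖w - o‖) := by nlinarith)
      exact ⟨h, h1, fun _ => h2⟩
    · exact ⟨id, rfl, fun h => absurd h hm⟩
  choose k hko hk using hsol
  have hsmall : ∀ τ > 0, ∀ᶠ m in atTop, ∀ w ∈ Metric.ball c (R / 2),
      ‖k m w - w‖ ≤ τ * ‖w - o‖ := by
    intro τ hτ
    filter_upwards [hgood_ev, hGs (τ * ‖α‖ / 2) (by positivity)] with m hm hGm w hw
    by_cases hwo : w = o
    · simp [hwo, hko m]
    · have hwo' := norm_pos_iff.2 (sub_ne_zero.2 hwo)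
      have h1 := (hk m hm w hw hwo).1
      have h2 := hGm w (hsub hw) hwo
      rw [zpow_add_one₀ hwo'.ne'] at h2
      rw [norm_mul, norm_zpow] at h1
      have h3 : 0 < ‖α‖ * ‖w - o‖ ^ n := by positivity
      refine le_of_mul_le_mul_right ?_ h3
      calc _ ≤ 2 * (τ * ‖α‖ / 2 * (‖w - o‖ ^ n * ‖w - o‖)) := by linarith
        _ = _ := by ring
  refine ⟨ρ, hρ, hball, k, hko, hsmall, ?_, hgood_ev.mono fun m hm w hw hwo =>
    (hk m hm w hw hwo).2⟩
  filter_upwards [hgood_ev, hsmall 1 one_pos] with m hm hs w hw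
  refine DifferentiableAt.differentiableWithinAt ?_
  by_cases hwo : w = o
  · -- at the singular point the solution is continuous, so the singularity is removable
    subst hwo
    refine (Complex.analyticAt_of_differentiable_on_punctured_nhds_of_continuousAt ?_
      ?_).differentiableAt
    · filter_upwards [nhdsWithin_le_nhds (Metric.isOpen_ball.mem_nhds hw), self_mem_nhdsWithin]
        with t ht hto
      exact (hk m hm t ht hto).2.1.differentiableAt
    · rw [ContinuousAt, hko m, tendsto_iff_norm_sub_tendsto_zero]
      have h0 : Tendsto (fun t : ℂ => 2 * ‖t - w‖) (𝓝 w) (𝓝 0) := by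
        have : ContinuousAt (fun t : ℂ => 2 * ‖t - w‖) w := by fun_prop
        simpa [ContinuousAt] using this
      refine squeeze_zero' (Eventually.of_forall fun t => norm_nonneg _) ?_ h0
      filter_upwards [Metric.isOpen_ball.mem_nhds hw] with t ht
      have h1 := hs t ht
      have h2 := norm_sub_le_norm_sub_add_norm_sub (k m t) t w
      linarith
  · exact (hk m hm w hw hwo).2.1.differentiableAt

/-! ### Domains with smooth boundary -/

/-- A sublevel set of a function with non-vanishing differential meets small balls in a connected
set: it is star-shaped with respect to a point on the side to which the function decreases. -/
theorem eventually_isPreconnected_ball_inter_sublevel {E : Type*} [NormedAddCommGroup E]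
    [NormedSpace ℝ E] {φ : E → ℝ} {L : E →L[ℝ] ℝ} {c : E} (hφ : HasStrictFDerivAt φ L c)
    (hL : L ≠ 0) (hc : φ c = 0) :
    ∀ᶠ r in 𝓝[>] (0 : ℝ), IsPreconnected (Metric.ball c r ∩ {x | φ x < 0}) := by
  have hl : 0 < ‖L‖ := norm_pos_iff.2 hL
  obtain ⟨v, hv1, hv⟩ : ∃ v : E, ‖v‖ ≤ 1 ∧ ‖L‖ / 2 < L v := by
    obtain ⟨v, hv, hLv⟩ := L.exists_lt_apply_of_lt_opNorm (half_lt_self hl)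
    rcases le_total 0 (L v) with h | h
    · exact ⟨v, hv.le, by rwa [Real.norm_of_nonneg h] at hLv⟩
    · exact ⟨-v, by rw [norm_neg]; exact hv.le, by rwa [Real.norm_of_nonpos h, ← map_neg] at hLv⟩
  have h1 := hφ.isLittleO.def (show 0 < ‖L‖ / 16 by positivity)
  rw [nhds_prod_eq] at h1
  obtain ⟨ε, hε, h1⟩ := (Metric.nhds_basis_ball.prod_self.eventually_iff).1 h1
  filter_upwards [Ioo_mem_nhdsGT hε] with r hr
  have hr0 : 0 < r := hr.1
  have herr : ∀ x ∈ Metric.ball c r, ∀ y ∈ Metric.ball c r,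
      φ x - φ y ≤ L (x - y) + ‖L‖ / 16 * ‖x - y‖ := by
    intro x hx y hy
    have hsub := Metric.ball_subset_ball (x := c) hr.2.le
    have := h1 (x := (x, y)) ⟨hsub hx, hsub hy⟩
    have := (le_abs_self _).trans this
    simp only at this
    linarith
  set q : E := c - (r / 2) • v with hq
  have hqc : L (q - c) ≤ -(‖L‖ * r / 4) := by
    rw [hq, sub_sub_cancel_left, map_neg, map_smul, smul_eq_mul]
    nlinarith
  have hqb : q ∈ Metric.ball c r := by
    rw [mem_ball_iff_norm, hq, sub_sub_cancel_left, norm_neg, norm_smul,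
      Real.norm_of_nonneg (by linarith)]
    nlinarith
  have hcb : c ∈ Metric.ball c r := Metric.mem_ball_self hr0
  have hneg : ∀ x ∈ Metric.ball c r, L (x - c) ≤ -(‖L‖ * r / 8) → φ x < 0 := by
    intro x hx h
    have h2 := herr x hx c hcb
    rw [mem_ball_iff_norm] at hx
    have : ‖L‖ / 16 * ‖x - c‖ ≤ ‖L‖ / 16 * r := by gcongr
    have : 0 < ‖L‖ * r := by positivity
    linarith
  have hstar : StarConvex ℝ q (Metric.ball c r ∩ {x | φ x < 0}) := by
    rintro z ⟨hz, hz0⟩ s t hs ht hst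
    have hzt : s • q + t • z ∈ Metric.ball c r := convex_ball c r hqb hz hs ht hst
    refine ⟨hzt, ?_⟩
    have hs1 : s = 1 - t := by linarith
    by_cases hcase : L (z - c) ≤ -(‖L‖ * r / 8)
    · refine hneg _ hzt ?_
      have : s • q + t • z - c = s • (q - c) + t • (z - c) := by
        rw [hs1]
        module
      rw [this, map_add, map_smul, map_smul, smul_eq_mul, smul_eq_mul]
      have h3 : 0 < ‖L‖ * r := by positivity
      nlinarith
    · have h2 := herr _ hzt z hz
      have h3 : s • q + t • z - z = s • (q - z) := by
        rw [hs1]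
        module
      have h4 : L (q - z) ≤ -(‖L‖ * r / 8) := by
        have : q - z = (q - c) - (z - c) := by abel
        rw [this, map_sub]
        linarith [not_le.1 hcase]
      have h5 : ‖q - z‖ ≤ 2 * r := by
        have := dist_triangle_right q z c
        rw [Metric.mem_ball] at hqb hz
        rw [dist_eq_norm] at this
        linarith
      rw [h3, map_smul, smul_eq_mul, norm_smul, Real.norm_of_nonneg hs] at h2
      have h6 : ‖L‖ / 16 * ‖q - z‖ ≤ ‖L‖ / 16 * (2 * r) := by gcongr
      have h7 : s * (L (q - z) + ‖L‖ / 16 * ‖q - z‖) ≤ 0 :=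
        mul_nonpos_of_nonneg_of_nonpos hs (by linarith)
      have h8 : φ z < 0 := hz0
      change φ (s • q + t • z) < 0
      linarith
  exact (hstar.isPathConnected ⟨hqb, hneg q hqb (by
    have : 0 < ‖L‖ * r := by positivity
    linarith)⟩).isConnected.isPreconnected

variable {X : Type*} [TopologicalSpace X] [ChartedSpace ℂ X]

/-- A domain with smooth boundary meets small discs around a point of its closure in a connected
set. -/
theorem IsSmoothDomain.eventually_isPreconnected {U : Set X} (hU : IsSmoothDomain U) {p : X}
    (hp : p ∈ closure U) : ∀ᶠ r in 𝓝[>] (0 : ℝ),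
      IsPreconnected (Metric.ball (chartAt ℂ p p) r ∩ (chartAt ℂ p).symm ⁻¹' U) := by
  have hpt := mem_chart_target ℂ p
  have hps : (chartAt ℂ p).symm (chartAt ℂ p p) = p := (chartAt ℂ p).left_inv (mem_chart_source ℂ p)
  by_cases hpU : p ∈ U
  · obtain ⟨ε, hε, hεs⟩ := exists_closedBall_subset_target hpt hU.1 (by rwa [hps])
    filter_upwards [Ioo_mem_nhdsGT hε] with r hr
    rw [inter_eq_left.2 fun t ht => (hεs (Metric.ball_subset_closedBall
      (Metric.ball_subset_ball hr.2.le ht))).2]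
    exact (convex_ball _ _).isPreconnected
  obtain ⟨V, hV, hpV, φ, hφ, hdφ, hUφ⟩ := hU.2 p ⟨hp, by rwa [hU.1.interior_eq]⟩
  have h1 : ContMDiffAt 𝓘(ℝ, ℂ) 𝓘(ℝ, ℝ) ∞ φ p := hφ.contMDiffAt (hV.mem_nhds hpV)
  have h2 : ContDiffAt ℝ ∞ (φ ∘ (chartAt ℂ p).symm) (chartAt ℂ p p) := by
    have h := (contMDiffAt_iff.1 h1).2
    simp only [mfld_simps, contDiffWithinAt_univ] at h
    exact h
  have h3 := h2.hasStrictFDerivAt (by simp)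
  have h4 : fderiv ℝ (φ ∘ (chartAt ℂ p).symm) (chartAt ℂ p p) ≠ 0 := by
    intro h0
    apply hdφ
    have h : fderivWithin ℝ (writtenInExtChartAt 𝓘(ℝ, ℂ) 𝓘(ℝ, ℝ) p φ) (range 𝓘(ℝ, ℂ))
        (extChartAt 𝓘(ℝ, ℂ) p p) = 0 := by
      simp only [writtenInExtChartAt, mfld_simps, fderivWithin_univ]
      exact h0
    exact (h1.mdifferentiableAt (by simp)).mfderiv.trans h
  have h5 : φ p = 0 := by
    refine le_antisymm ?_ (not_lt.1 fun h => hpU ((hUφ p hpV).2 h))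
    have hc : ContinuousAt φ p := h1.continuousAt
    by_contra hpos
    have h6 := (hc.eventually (lt_mem_nhds (not_le.1 hpos))).and (hV.mem_nhds hpV)
    obtain ⟨y, hy, hyU⟩ := mem_closure_iff_nhds.1 hp _ h6
    exact lt_asymm hy.1 ((hUφ y hy.2).1 hyU)
  obtain ⟨ε, hε, hεs⟩ := exists_closedBall_subset_target hpt hV (by rwa [hps])
  filter_upwards [Ioo_mem_nhdsGT hε, eventually_isPreconnected_ball_inter_sublevel h3 h4
    (by rw [Function.comp_apply, hps, h5])] with r hr h
  convert h using 1
  ext t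
  constructor
  · rintro ⟨ht, htU⟩
    exact ⟨ht, (hUφ _ (hεs (Metric.ball_subset_closedBall
      (Metric.ball_subset_ball hr.2.le ht))).2).1 htU⟩
  · rintro ⟨ht, htU⟩
    exact ⟨ht, (hUφ _ (hεs (Metric.ball_subset_closedBall
      (Metric.ball_subset_ball hr.2.le ht))).2).2 htU⟩

end RiemannSurface

namespace RiemannSurface

/-! ### Local solutions -/

theorem tendsto_nhdsNE_of_mem_source {X Y : Type*} [TopologicalSpace X] [TopologicalSpace Y]
    (e : OpenPartialHomeomorph X Y) {x : X} (hx : x ∈ e.source) :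
    Tendsto e (𝓝[≠] x) (𝓝[≠] (e x)) := by
  refine tendsto_nhdsWithin_iff.2 ⟨(e.continuousAt hx).tendsto.mono_left nhdsWithin_le_nhds, ?_⟩
  filter_upwards [self_mem_nhdsWithin, nhdsWithin_le_nhds (e.open_source.mem_nhds hx)]
    with y hy hys h
  exact hy (e.injOn hys hx h)

theorem eventually_nhdsNE_notMem_of_isDiscrete {X : Type*} [TopologicalSpace X] {S : Set X}
    (hS : IsDiscrete S) {x : X} (hx : x ∈ S) : ∀ᶠ y in 𝓝[≠] x, y ∉ S := by
  have h := isDiscrete_iff_nhdsWithin.1 hS x hx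
  have h1 : ∀ᶠ y in 𝓝[S] x, y = x := by
    rw [h]
    exact mem_pure.2 rfl
  rw [eventually_nhdsWithin_iff] at h1 ⊢
  filter_upwards [h1] with y hy hyx hyS
  exact hyx (hy hyS)

variable {X : Type*} [TopologicalSpace X] [ChartedSpace ℂ X]

theorem nhdsNE_neBot_of_chartedSpace (x : X) : (𝓝[≠] x).NeBot := by
  have h := tendsto_nhdsNE_of_mem_source (chartAt ℂ x).symm (mem_chart_target ℂ x)
  rw [(chartAt ℂ x).left_inv (mem_chart_source ℂ x)] at h
  exact h.neBot

variable [IsManifold 𝓘(ℂ, ℂ) ω X]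

namespace MeromorphicForm

variable {W : Set X}

/-- Since its zeros are isolated, the form vanishes identically on no open set. -/
theorem ord_ne_top [T2Space X] (θ : MeromorphicForm W) (hW : IsOpen W) (hZ : IsDiscrete θ.zeros)
    (hP : IsDiscrete θ.poles) {x : X} (hx : x ∈ W) : θ.ord x ≠ ⊤ := by
  intro htop
  have hxZ : x ∈ θ.zeros := ⟨hx, by rw [htop]; exact WithTop.coe_lt_top 0⟩
  have h1 := meromorphicOrderAt_eq_top_iff.1 htop
  have h2 : ∀ᶠ y in 𝓝[≠] x, y ∈ θ.poles := by
    filter_upwards [(tendsto_nhdsNE_of_mem_source _ (mem_chart_source ℂ x)).eventually h1,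
      eventually_nhdsNE_notMem_of_isDiscrete hZ hxZ, nhdsWithin_le_nhds (hW.mem_nhds hx),
      nhdsWithin_le_nhds ((chartAt ℂ x).open_source.mem_nhds (mem_chart_source ℂ x))]
      with y hy1 hy2 hy3 hy4
    rw [coeff_eq_zero_iff _ (chart_mem_atlas ℂ x) ((chartAt ℂ x).map_source hy4),
      (chartAt ℂ x).left_inv hy4] at hy1
    exact ((θ.apply_eq_zero_iff hy3).1 hy1).resolve_left hy2
  have := nhdsNE_neBot_of_chartedSpace x
  rw [eventually_nhdsWithin_iff, ← eventually_eventually_nhds] at h2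
  have h3 : ∀ᶠ y in 𝓝[≠] x, ∀ᶠ u in 𝓝 y, u ≠ x → u ∈ θ.poles := nhdsWithin_le_nhds h2
  obtain ⟨y, hy, hyx⟩ := (h3.and self_mem_nhdsWithin).exists
  have h4 : ∀ᶠ u in 𝓝 y, u ∈ θ.poles := by
    filter_upwards [hy, isOpen_ne.mem_nhds hyx] with u hu hux using hu hux
  have := nhdsNE_neBot_of_chartedSpace y
  obtain ⟨u, hu1, hu2⟩ := ((eventually_nhdsNE_notMem_of_isDiscrete hP h4.self_of_nhds).and
    (nhdsWithin_le_nhds h4)).exists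
  exact hu1 hu2

/-- The zeros and poles are isolated. -/
theorem eventually_notMem_zeros_union_poles [T2Space X] (θ : MeromorphicForm W) (hW : IsOpen W)
    (hZ : IsDiscrete θ.zeros) (hP : IsDiscrete θ.poles) {x : X} (hx : x ∈ W) :
    ∀ᶠ y in 𝓝[≠] x, y ∉ θ.zeros ∪ θ.poles := by
  have h1 := (meromorphicOrderAt_ne_top_iff_eventually_ne_zero
    (θ.meromorphic x hx).meromorphicAt).1 (θ.ord_ne_top hW hZ hP hx)
  filter_upwards [(tendsto_nhdsNE_of_mem_source _ (mem_chart_source ℂ x)).eventually h1,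
    nhdsWithin_le_nhds (hW.mem_nhds hx),
    nhdsWithin_le_nhds ((chartAt ℂ x).open_source.mem_nhds (mem_chart_source ℂ x))]
    with y hy1 hy2 hy3
  rwa [ne_eq, coeff_eq_zero_iff _ (chart_mem_atlas ℂ x) ((chartAt ℂ x).map_source hy3),
    (chartAt ℂ x).left_inv hy3, θ.apply_eq_zero_iff hy2] at hy1

theorem isOpen_sdiff_poles [T2Space X] (θ : MeromorphicForm W) (hW : IsOpen W)
    (hZ : IsDiscrete θ.zeros) (hP : IsDiscrete θ.poles) {U : Set X} (hU : IsOpen U) (hUW : U ⊆ W) :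
    IsOpen (U \ θ.poles) := by
  rw [isOpen_iff_mem_nhds]
  rintro x ⟨hxU, hxP⟩
  have h1 := eventually_nhdsWithin_iff.1
    (θ.eventually_notMem_zeros_union_poles hW hZ hP (hUW hxU))
  filter_upwards [h1, hU.mem_nhds hxU] with y hy hyU
  refine ⟨hyU, fun hyP => ?_⟩
  by_cases hyx : y = x
  · exact hxP (hyx ▸ hyP)
  · exact hy hyx (Or.inr hyP)

end MeromorphicForm

/-- The hypotheses on the sequences of forms, together with a sequence `g` of primitives of
`η m - ν m` that vanish on the zeros and tend to zero. -/
structure ConvergingPair (U W : Set X) (ν η : ℕ → MeromorphicForm W) (θ : MeromorphicForm W)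
    (g : ℕ → X → ℂ) : Prop where
  smooth : IsSmoothDomain U
  isOpen : IsOpen W
  closure_subset : closure U ⊆ W
  zeros_subset : θ.zeros ⊆ U
  poles_subset : θ.poles ⊆ U
  zeros_discrete : IsDiscrete θ.zeros
  poles_discrete : IsDiscrete θ.poles
  poles_left : ∀ m, (ν m).poles = θ.poles
  poles_right : ∀ m, (η m).poles = θ.poles
  ord_left : ∀ m, ∀ x ∈ U, (ν m).ord x = θ.ord x
  ord_right : ∀ m, ∀ x ∈ U, (η m).ord x = θ.ord x
  tendsto : TendstoUniformlyOnCompacts (fun m => (ν m).toFun) θ.toFun (W \ θ.poles)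
  tendsto_sub : ∀ e ∈ atlas ℂ X, ∀ K ⊆ e.target ∩ e.symm ⁻¹' (W \ θ.poles), IsCompact K →
    TendstoUniformlyOn (fun m z => coeff (η m).toFun e z - coeff (ν m).toFun e z) (fun _ => 0)
      atTop K
  primitive_zeros : ∀ m, ∀ x ∈ θ.zeros, g m x = 0
  primitive : ∀ m, ∀ e ∈ atlas ℂ X, ∀ z ∈ e.target, e.symm z ∈ U \ θ.poles →
    HasDerivAt (g m ∘ e.symm) (coeff (η m).toFun e z - coeff (ν m).toFun e z) z
  primitive_tendsto : ∀ e ∈ atlas ℂ X, ∀ K ⊆ e.target ∩ e.symm ⁻¹' (U \ θ.poles), IsCompact K →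
    TendstoUniformlyOn (fun m => g m ∘ e.symm) (fun _ => 0) atTop K

/-- What is needed of the forms in the disc of radius `R` in the chart at `x` in order to solve the
integral equation there: up to a point `o`, which is the centre if `x` is a zero or a pole and lies
outside the disc otherwise, the forms `ν m` are close to a monomial and `η m - ν m` has
a small primitive, which agrees with `g m` on `U`. -/
structure LocalModel (U W : Set X) (ν η : ℕ → MeromorphicForm W) (θ : MeromorphicForm W)
    (g : ℕ → X → ℂ) (x : X) (R : ℝ) (o α : ℂ) (n : ℤ) (G : ℕ → ℂ → ℂ) : Prop where
  pos : 0 < R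
  ne_zero : α ≠ 0
  subset : Metric.ball (chartAt ℂ x x) R ⊆ (chartAt ℂ x).target ∩ (chartAt ℂ x).symm ⁻¹' W
  eq_center : o ∈ Metric.ball (chartAt ℂ x x) R → o = chartAt ℂ x x
  mem_iff : ∀ w ∈ Metric.ball (chartAt ℂ x x) R,
    (chartAt ℂ x).symm w ∈ θ.zeros ∪ θ.poles ↔ w = o
  near : ∀ᶠ m in atTop, NearMonomial (coeff (ν m).toFun (chartAt ℂ x)) o α n
    (Metric.ball (chartAt ℂ x x) R)
  deriv : ∀ m, ∀ w ∈ Metric.ball (chartAt ℂ x x) R, w ≠ o →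
    HasDerivAt (G m) (coeff (η m).toFun (chartAt ℂ x) w - coeff (ν m).toFun (chartAt ℂ x) w) w
  small : ∀ ε > 0, ∀ᶠ m in atTop, ∀ w ∈ Metric.ball (chartAt ℂ x x) R, w ≠ o →
    ‖G m w‖ ≤ ε * ‖w - o‖ ^ (n + 1)
  eq_primitive : ∀ m, ∀ w ∈ Metric.ball (chartAt ℂ x x) R, w ≠ o → (chartAt ℂ x).symm w ∈ U →
    G m w = g m ((chartAt ℂ x).symm w)

namespace ConvergingPair

variable {U W : Set X} {ν η : ℕ → MeromorphicForm W} {θ : MeromorphicForm W} {g : ℕ → X → ℂ}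

/-- At an ordinary point of `closure U` the primitive on the disc is normalised to agree with `g m`
at one point of `U`; it then agrees with `g m` on `U`, which meets the disc in a connected set. -/
theorem exists_localModel_of_notMem (h : ConvergingPair U W ν η θ g) {x : X} (hx : x ∈ closure U)
    (hxS : x ∉ θ.zeros ∪ θ.poles) : ∃ R o α n G, LocalModel U W ν η θ g x R o α n G := by
  set e := chartAt ℂ x with he
  set c := e x with hc
  have hxW := h.closure_subset hx
  have hea : e ∈ atlas ℂ X := chart_mem_atlas ℂ x
  have hct : c ∈ e.target := mem_chart_target ℂ x
  have hec : e.symm c = x := e.left_inv (mem_chart_source ℂ x)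
  set a := coeff θ.toFun e with ha
  set α := a c with hα
  have hα0 : α ≠ 0 := by
    rw [hα, ha, ne_eq, coeff_eq_zero_iff _ hea hct, hec, θ.apply_eq_zero_iff hxW]
    exact hxS
  have hα' := norm_pos_iff.2 hα0
  have hac : ContinuousAt a c := (θ.analyticAt_coeff hea hct (by rwa [hec])
    (by rw [hec]; exact fun hp => hxS (Or.inr hp))).continuousAt
  have hev : ∀ᶠ t in 𝓝 c, (t ∈ e.target ∧ e.symm t ∈ W) ∧ ‖a t - α‖ < ‖α‖ / 16 := by
    refine (eventually_mem_target_and_symm_mem hct h.isOpen (by rwa [hec])).and ?_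
    have := Metric.tendsto_nhds.1 hac (‖α‖ / 16) (by positivity)
    simpa only [dist_eq_norm] using this
  obtain ⟨ε, hε, hεs⟩ := Metric.nhds_basis_ball.eventually_iff.1 hev
  obtain ⟨R, hRε, hpre⟩ := ((show ∀ᶠ r in 𝓝[>] (0 : ℝ), r ∈ Ioo 0 ε from Ioo_mem_nhdsGT hε).and
    (h.smooth.eventually_isPreconnected hx)).exists
  rw [← he, ← hc] at hpre
  have hR : 0 < R := hRε.1
  have hsub : Metric.closedBall c R ⊆ Metric.ball c ε := Metric.closedBall_subset_ball hRε.2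
  have hbsub : Metric.ball c R ⊆ Metric.ball c ε := Metric.ball_subset_ball hRε.2.le
  have hnS : ∀ w ∈ Metric.ball c ε, e.symm w ∉ θ.zeros ∪ θ.poles := by
    intro w hw hwS
    obtain ⟨⟨h1, h2⟩, h3⟩ := hεs hw
    rw [← θ.apply_eq_zero_iff h2, ← coeff_eq_zero_iff _ hea h1] at hwS
    change ‖coeff θ.toFun e w - α‖ < _ at h3
    rw [hwS, zero_sub, norm_neg] at h3
    linarith
  have hnP : ∀ w ∈ Metric.ball c ε, e.symm w ∈ W \ θ.poles := fun w hw =>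
    ⟨(hεs hw).1.2, fun hp => hnS w hw (Or.inr hp)⟩
  have hcomp : Metric.closedBall c R ⊆ e.target ∩ e.symm ⁻¹' (W \ θ.poles) := fun w hw =>
    ⟨(hεs (hsub hw)).1.1, hnP w (hsub hw)⟩
  obtain ⟨w₀, hw₀, hw₀U⟩ : ∃ w₀ ∈ Metric.ball c R, e.symm w₀ ∈ U := by
    have h1 : ∀ᶠ y in 𝓝 x, y ∈ e.source ∧ e y ∈ Metric.ball c R :=
      (e.open_source.eventually_mem (mem_chart_source ℂ x)).and
        ((e.continuousAt (mem_chart_source ℂ x)).eventually (Metric.ball_mem_nhds c hR))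
    obtain ⟨y, hy, hyU⟩ := mem_closure_iff_nhds.1 hx _ h1
    exact ⟨e y, hy.2, by rwa [e.left_inv hy.1]⟩
  -- the point `o` is put outside the disc, at distance at least `1` from its points
  set o : ℂ := c + ((R + 1 : ℝ) : ℂ) with ho
  have hoc : ‖c - o‖ = R + 1 := by
    rw [ho, sub_add_cancel_left, norm_neg, Complex.norm_real, Real.norm_of_nonneg (by linarith)]
  have hod : ∀ w ∈ Metric.ball c R, 1 ≤ ‖w - o‖ := by
    intro w hw
    rw [mem_ball_iff_norm'] at hw
    have := norm_sub_le_norm_sub_add_norm_sub c w o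
    linarith
  have honot : o ∉ Metric.ball c R := fun ho' => by
    have := hod o ho'
    simp at this
    linarith
  have hdiff : ∀ α : MeromorphicForm W, α.poles = θ.poles →
      DifferentiableOn ℂ (coeff α.toFun e) (Metric.ball c ε) := fun α hα w hw =>
    (α.analyticAt_coeff hea (hεs hw).1.1 (hεs hw).1.2
      (by rw [hα]; exact (hnP w hw).2)).differentiableAt.differentiableWithinAt
  have hG : ∀ m, ∃ G : ℂ → ℂ, G w₀ = g m (e.symm w₀) ∧ ∀ w ∈ Metric.ball c ε,
      HasDerivAt G (coeff (η m).toFun e w - coeff (ν m).toFun e w) w := fun m =>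
    (((hdiff _ (h.poles_right m)).sub (hdiff _ (h.poles_left m))).isExactOn_ball).with_val_at
      w₀ _
  choose G hG₀ hG using hG
  refine ⟨R, o, α, 0, G, hR, hα0, fun w hw => (hεs (hbsub hw)).1, fun ho' => absurd ho' honot,
    fun w hw => ⟨fun hS => absurd hS (hnS w (hbsub hw)), ?_⟩, ?_, fun m w hw _ => hG m w (hbsub hw),
    ?_, ?_⟩
  · rintro rfl
    exact absurd hw honot
  · have h1 := Metric.tendstoUniformlyOn_iff.1 (h.tendsto e hea _ hcomp (isCompact_closedBall c R))
      (‖α‖ / 16) (by positivity)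
    filter_upwards [h1] with m hm w hw _
    have h2 := hm w (Metric.ball_subset_closedBall hw)
    rw [dist_eq_norm, norm_sub_rev] at h2
    have h3 := (hεs (hbsub hw)).2
    rw [zpow_zero, mul_one]
    have h4 := norm_sub_le_norm_sub_add_norm_sub (coeff (ν m).toFun e w) (a w) α
    linarith
  · intro δ hδ
    have h1 := eventually_norm_sub_le_of_tendstoUniformlyOn hR (fun m t ht => hG m t (hsub ht))
      (h.tendsto_sub e hea _ hcomp (isCompact_closedBall c R)) (half_pos hδ)
    have h2 := Metric.tendstoUniformlyOn_iff.1 (h.primitive_tendsto e hea {w₀} (by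
      rintro _ rfl
      exact ⟨(hεs (hbsub hw₀)).1.1, hw₀U, (hnP _ (hbsub hw₀)).2⟩) isCompact_singleton) (δ / 2)
      (half_pos hδ)
    filter_upwards [h1, h2] with m hm1 hm2 w hw _
    have h3 := hm1 w (Metric.ball_subset_closedBall hw) w₀ (Metric.ball_subset_closedBall hw₀)
    have h4 := hm2 w₀ rfl
    rw [dist_zero_left, Function.comp_apply, ← hG₀ m] at h4
    have h5 := norm_le_norm_sub_add (G m w) (G m w₀)
    rw [zero_add, zpow_one]
    have h6 := hod w hw
    nlinarith
  · intro m w hw _ hwU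
    have hopen : IsOpen (Metric.ball c R ∩ e.symm ⁻¹' U) := by
      have h1 : Metric.ball c R ∩ e.symm ⁻¹' U =
          Metric.ball c R ∩ (e.target ∩ e.symm ⁻¹' U) := by
        ext t
        exact ⟨fun ht => ⟨ht.1, (hεs (hbsub ht.1)).1.1, ht.2⟩, fun ht => ⟨ht.1, ht.2.2⟩⟩
      rw [h1]
      exact Metric.isOpen_ball.inter (e.isOpen_inter_preimage_symm h.smooth.1)
    have hder : ∀ t ∈ Metric.ball c R ∩ e.symm ⁻¹' U,
        HasDerivAt (fun t => G m t - (g m ∘ e.symm) t) 0 t := by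
      rintro t ⟨ht, htU⟩
      have := (hG m t (hbsub ht)).fun_sub (h.primitive m e hea t (hεs (hbsub ht)).1.1
        ⟨htU, (hnP t (hbsub ht)).2⟩)
      rwa [sub_self] at this
    have h2 := hopen.is_const_of_deriv_eq_zero hpre
      (fun t ht => (hder t ht).differentiableAt.differentiableWithinAt)
      (fun t ht => (hder t ht).deriv) ⟨hw, hwU⟩ ⟨hw₀, hw₀U⟩
    simp only [Function.comp_apply, hG₀ m, sub_self] at h2
    exact sub_eq_zero.1 h2

/-- At a zero or pole the estimates are obtained on a circle, where the sequences converge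
uniformly, and propagate to the disc because the orders at the centre agree. -/
theorem exists_localModel_of_mem [T2Space X] (h : ConvergingPair U W ν η θ g) {x : X}
    (hxS : x ∈ θ.zeros ∪ θ.poles) : ∃ R o α n G, LocalModel U W ν η θ g x R o α n G := by
  set e := chartAt ℂ x with he
  set c := e x with hc
  have hUW : U ⊆ W := subset_closure.trans h.closure_subset
  have hxU : x ∈ U := hxS.elim (fun hz => h.zeros_subset hz) (fun hp => h.poles_subset hp)
  have hxW := hUW hxU
  have hea : e ∈ atlas ℂ X := chart_mem_atlas ℂ x
  have hct : c ∈ e.target := mem_chart_target ℂ x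
  have hec : e.symm c = x := e.left_inv (mem_chart_source ℂ x)
  obtain ⟨n, hn⟩ := WithTop.ne_top_iff_exists.1
    (θ.ord_ne_top h.isOpen h.zeros_discrete h.poles_discrete hxW)
  have hmer : ∀ β : MeromorphicForm W, MeromorphicAt (coeff β.toFun e) c := fun β =>
    (β.meromorphic x hxW).meromorphicAt
  obtain ⟨α, hα0, hα⟩ := exists_norm_sub_le_of_meromorphicOrderAt_eq (hmer θ) hn.symm
    (show (0 : ℝ) < 1 / 16 by norm_num)
  have hα' := norm_pos_iff.2 hα0
  have hiso := (tendsto_nhdsNE_of_mem_source e.symm hct).eventually (by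
    rw [hec]
    exact θ.eventually_notMem_zeros_union_poles h.isOpen h.zeros_discrete h.poles_discrete hxW)
  have hev : ∀ᶠ t in 𝓝 c, (t ∈ e.target ∧ e.symm t ∈ U) ∧ (t ≠ c →
      e.symm t ∉ θ.zeros ∪ θ.poles ∧ ‖coeff θ.toFun e t - α * (t - c) ^ n‖ ≤
        1 / 16 * ‖α * (t - c) ^ n‖) :=
    (eventually_mem_target_and_symm_mem hct h.smooth.1 (by rwa [hec])).and
      (eventually_nhdsWithin_iff.1 (hiso.and hα))
  obtain ⟨ε, hε, hεs⟩ := Metric.nhds_basis_ball.eventually_iff.1 hev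
  set R := ε / 2 with hR
  have hR0 : 0 < R := half_pos hε
  have hRε : R < ε := half_lt_self hε
  have hsub : Metric.closedBall c R ⊆ Metric.ball c ε := Metric.closedBall_subset_ball hRε
  have hbsub : Metric.ball c R ⊆ Metric.ball c ε := Metric.ball_subset_ball hRε.le
  have hnP : ∀ w ∈ Metric.ball c ε, w ≠ c → e.symm w ∈ U \ θ.poles := fun w hw hwc =>
    ⟨(hεs hw).1.2, fun hp => ((hεs hw).2 hwc).1 (Or.inr hp)⟩
  have hdiff : ∀ β : MeromorphicForm W, β.poles = θ.poles →
      DifferentiableOn ℂ (coeff β.toFun e) (Metric.ball c ε \ {c}) := fun β hβ w hw =>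
    (β.analyticAt_coeff hea (hεs hw.1).1.1 (hUW (hεs hw.1).1.2)
      (by rw [hβ]; exact (hnP w hw.1 hw.2).2)).differentiableAt.differentiableWithinAt
  have hsph : Metric.sphere c R ⊆ e.target ∩ e.symm ⁻¹' (U \ θ.poles) := by
    intro w hw
    have hwc : w ≠ c := by
      rintro rfl
      simp at hw
      exact hR0.ne hw
    have hw' := hsub (Metric.sphere_subset_closedBall hw)
    exact ⟨(hεs hw').1.1, hnP w hw' hwc⟩
  have hsphW : Metric.sphere c R ⊆ e.target ∩ e.symm ⁻¹' (W \ θ.poles) := fun w hw =>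
    ⟨(hsph hw).1, hUW (hsph hw).2.1, (hsph hw).2.2⟩
  have hsubord : ∀ f₁ f₂ : ℂ → ℂ, MeromorphicAt f₁ c → MeromorphicAt f₂ c →
      meromorphicOrderAt f₁ c = n → meromorphicOrderAt f₂ c = n →
      (n : WithTop ℤ) ≤ meromorphicOrderAt (f₁ - f₂) c := by
    intro f₁ f₂ h1 h2 h3 h4
    have h5 := meromorphicOrderAt_add h1 h2.neg
    rw [← meromorphicOrderAt_neg (f := f₂), h3, h4, min_self, ← sub_eq_add_neg] at h5
    exact h5
  have hgd : ∀ m, ∀ w ∈ Metric.ball c ε, w ≠ c →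
      HasDerivAt (g m ∘ e.symm) (coeff (η m).toFun e w - coeff (ν m).toFun e w) w :=
    fun m w hw hwc => h.primitive m e hea w (hεs hw).1.1 (hnP w hw hwc)
  have hordν : ∀ m, meromorphicOrderAt (coeff (ν m).toFun e) c = n := fun m =>
    (h.ord_left m x hxU).trans hn.symm
  have hordη : ∀ m, meromorphicOrderAt (coeff (η m).toFun e) c = n := fun m =>
    (h.ord_right m x hxU).trans hn.symm
  refine ⟨R, c, α, n, fun m => g m ∘ e.symm, hR0, hα0,
    fun w hw => ⟨(hεs (hbsub hw)).1.1, hUW (hεs (hbsub hw)).1.2⟩, fun _ => rfl, ?_, ?_,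
    fun m w hw hwc => hgd m w (hbsub hw) hwc, ?_, fun m w _ _ _ => rfl⟩
  · intro w hw
    constructor
    · intro hS
      by_contra hwc
      exact ((hεs (hbsub hw)).2 hwc).1 hS
    · rintro rfl
      rwa [hec]
  · have h1 := eventually_norm_le_zpow (n := n) hR0 hRε
      (d := fun m => coeff (ν m).toFun e - coeff θ.toFun e)
      (fun m => (hdiff _ (h.poles_left m)).sub (hdiff _ rfl))
      (fun m => (hmer _).sub (hmer _)) (fun m => hsubord _ _ (hmer _) (hmer _) (hordν m) hn.symm)
      (by
        have := h.tendsto e hea _ hsphW (isCompact_sphere c R)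
        rw [Metric.tendstoUniformlyOn_iff] at this ⊢
        intro δ hδ
        filter_upwards [this δ hδ] with m hm w hw
        rw [dist_zero_left, Pi.sub_apply, ← dist_eq_norm, dist_comm]
        exact hm w hw) (ε := ‖α‖ / 16) (by positivity)
    filter_upwards [h1] with m hm w hw hwc
    have h2 := hm w (Metric.ball_subset_closedBall hw) hwc
    have h3 := ((hεs (hbsub hw)).2 hwc).2
    have h4 := norm_sub_le_norm_sub_add_norm_sub (coeff (ν m).toFun e w) (coeff θ.toFun e w)
      (α * (w - c) ^ n)
    rw [Pi.sub_apply] at h2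
    rw [norm_mul, norm_zpow] at h3 ⊢
    linarith
  · intro δ hδ
    have hgm : ∀ m, MeromorphicAt (g m ∘ e.symm) c := fun m =>
      meromorphicAt_of_hasDerivAt hε (hgd m) ((hmer (η m)).sub (hmer (ν m)))
    have h1 := eventually_norm_le_zpow (n := n + 1) (d := fun m => g m ∘ e.symm) hR0 hRε
      (fun m w hw => (hgd m w hw.1 hw.2).differentiableAt.differentiableWithinAt) hgm
      (fun m => succ_le_meromorphicOrderAt_of_hasDerivAt hε (hgd m)
        (hsubord _ _ (hmer _) (hmer _) (hordη m) (hordν m)) (fun hn0 => by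
          have hxP : x ∉ θ.poles := by
            rintro ⟨-, hneg⟩
            rw [← hn] at hneg
            exact absurd hneg (not_lt.2 (by exact_mod_cast hn0))
          refine ⟨?_, ?_⟩
          · refine DifferentiableOn.analyticAt (s := Metric.ball c ε) (fun w hw => ?_)
              (Metric.ball_mem_nhds c hε)
            refine (h.primitive m e hea w (hεs hw).1.1
              ⟨(hεs hw).1.2, ?_⟩).differentiableAt.differentiableWithinAt
            by_cases hwc : w = c
            · rwa [hwc, hec]
            · exact (hnP w hw hwc).2
          · rw [Function.comp_apply, hec]
            exact h.primitive_zeros m x (hxS.resolve_right hxP)))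
      (h.primitive_tendsto e hea _ hsph (isCompact_sphere c R)) hδ
    filter_upwards [h1] with m hm w hw hwc
    exact hm w (Metric.ball_subset_closedBall hw) hwc

end ConvergingPair

end RiemannSurface

namespace RiemannSurface

variable {X : Type*} [TopologicalSpace X] [ChartedSpace ℂ X]

/-- A sequence `k` of holomorphic functions on the closed disc of radius `r` in the chart at `x`
which tends to the identity and solves the equation `∫_w^{k(w)} ν m = g m`. The equation is
expressed by means of a primitive `F` of `ν m` on a ball around `w` of radius proportional to the
distance of `w` from `o`. -/
structure LocalSolution (U W : Set X) (ν η : ℕ → MeromorphicForm W) (θ : MeromorphicForm W)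
    (g : ℕ → X → ℂ) (x : X) (r : ℝ) (o : ℂ) (ρ : ℝ) (k : ℕ → ℂ → ℂ) : Prop where
  pos : 0 < r
  ratio_pos : 0 < ρ
  subset : Metric.closedBall (chartAt ℂ x x) r ⊆
    (chartAt ℂ x).target ∩ (chartAt ℂ x).symm ⁻¹' W
  ball_subset : ∀ w ∈ Metric.closedBall (chartAt ℂ x x) r, Metric.ball w (ρ * ‖w - o‖) ⊆
    (chartAt ℂ x).target ∩ (chartAt ℂ x).symm ⁻¹' W
  eq_center : o ∈ Metric.closedBall (chartAt ℂ x x) r → o = chartAt ℂ x x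
  mem_iff : ∀ w ∈ Metric.closedBall (chartAt ℂ x x) r,
    (chartAt ℂ x).symm w ∈ θ.zeros ∪ θ.poles ↔ w = o
  fixed : ∀ m, k m o = o
  small : ∀ τ > 0, ∀ᶠ m in atTop, ∀ w ∈ Metric.closedBall (chartAt ℂ x x) r,
    ‖k m w - w‖ ≤ τ * ‖w - o‖
  differentiable : ∀ᶠ m in atTop, ∀ w ∈ Metric.closedBall (chartAt ℂ x x) r,
    DifferentiableAt ℂ (k m) w
  solution : ∀ᶠ m in atTop, ∀ w ∈ Metric.closedBall (chartAt ℂ x x) r, w ≠ o →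
    coeff (ν m).toFun (chartAt ℂ x) (k m w) * _root_.deriv (k m) w =
      coeff (η m).toFun (chartAt ℂ x) w ∧
    ∃ F : ℂ → ℂ, (∀ t ∈ Metric.ball w (ρ * ‖w - o‖),
        HasDerivAt F (coeff (ν m).toFun (chartAt ℂ x) t) t) ∧
      InjOn F (Metric.ball w (ρ * ‖w - o‖)) ∧ k m w ∈ Metric.ball w (ρ * ‖w - o‖) ∧
      ((chartAt ℂ x).symm w ∈ U → F (k m w) - F w = g m ((chartAt ℂ x).symm w))

variable {U W : Set X} {ν η : ℕ → MeromorphicForm W} {θ : MeromorphicForm W} {g : ℕ → X → ℂ}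

theorem LocalSolution.small_uniform {x : X} {r : ℝ} {o : ℂ} {ρ : ℝ} {k : ℕ → ℂ → ℂ}
    (h : LocalSolution U W ν η θ g x r o ρ k) (τ : ℝ) (hτ : 0 < τ) :
    ∀ᶠ m in atTop, ∀ w ∈ Metric.closedBall (chartAt ℂ x x) r, ‖k m w - w‖ ≤ τ := by
  have hr := h.pos
  set L : ℝ := r + ‖chartAt ℂ x x - o‖ with hL
  have hL0 : 0 < L := by positivity
  filter_upwards [h.small (τ / L) (by positivity)] with m hm w hw
  have h1 : ‖w - o‖ ≤ L := by
    have := norm_sub_le_norm_sub_add_norm_sub w (chartAt ℂ x x) o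
    have := mem_closedBall_iff_norm.1 hw
    linarith
  calc ‖k m w - w‖ ≤ τ / L * ‖w - o‖ := hm w hw
    _ ≤ τ / L * L := by gcongr
    _ = τ := by field_simp

variable [IsManifold 𝓘(ℂ, ℂ) ω X]

theorem LocalModel.exists_localSolution {x : X} {R : ℝ} {o α : ℂ} {n : ℤ} {G : ℕ → ℂ → ℂ}
    (h : ConvergingPair U W ν η θ g) (hL : LocalModel U W ν η θ g x R o α n G) :
    ∃ r o ρ k, LocalSolution U W ν η θ g x r o ρ k := by
  have hea : chartAt ℂ x ∈ atlas ℂ X := chart_mem_atlas ℂ x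
  have hR := hL.pos
  obtain ⟨ρ, hρ, hball, k, hko, hsmall, hdiff, hsol⟩ := exists_solution_sequence hL.pos hL.ne_zero
    hL.near (fun m w hw => ((ν m).analyticAt_coeff hea (hL.subset hw.1).1 (hL.subset hw.1).2
      (by
        rw [h.poles_left m]
        exact fun hp => hw.2 ((hL.mem_iff w hw.1).1
          (Or.inr hp)))).differentiableAt.differentiableWithinAt)
    hL.deriv hL.small
  have hsub : Metric.closedBall (chartAt ℂ x x) (R / 4) ⊆ Metric.ball (chartAt ℂ x x) (R / 2) :=
    Metric.closedBall_subset_ball (by linarith)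
  have hsub' : Metric.ball (chartAt ℂ x x) (R / 2) ⊆ Metric.ball (chartAt ℂ x x) R :=
    Metric.ball_subset_ball (by linarith)
  refine ⟨R / 4, o, ρ, k, by positivity, hρ, fun w hw => hL.subset (hsub' (hsub hw)),
    fun w hw => (hball w (hsub hw)).trans hL.subset, fun ho => hL.eq_center (hsub' (hsub ho)),
    fun w hw => hL.mem_iff w (hsub' (hsub hw)), hko, ?_, ?_, ?_⟩
  · intro τ hτ
    filter_upwards [hsmall τ hτ] with m hm w hw using hm w (hsub hw)
  · filter_upwards [hdiff] with m hm w hw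
    exact (hm w (hsub hw)).differentiableAt (Metric.isOpen_ball.mem_nhds (hsub hw))
  · filter_upwards [hsol] with m hm w hw hwo
    obtain ⟨h1, h2, F, h3, h4, h5, h6⟩ := hm w (hsub hw) hwo
    refine ⟨?_, F, h3, h4, h5, fun hU => ?_⟩
    · rw [h1.deriv]
      field_simp
    · rw [h6, hL.eq_primitive m w (hsub' (hsub hw)) hwo hU]

theorem ConvergingPair.exists_localSolution [T2Space X] (h : ConvergingPair U W ν η θ g) {x : X}
    (hx : x ∈ closure U) : ∃ r o ρ k, LocalSolution U W ν η θ g x r o ρ k := by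
  by_cases hxS : x ∈ θ.zeros ∪ θ.poles
  · obtain ⟨R, o, α, n, G, hL⟩ := h.exists_localModel_of_mem hxS
    exact hL.exists_localSolution h
  · obtain ⟨R, o, α, n, G, hL⟩ := h.exists_localModel_of_notMem hx hxS
    exact hL.exists_localSolution h

/-! ### Uniqueness and injectivity of the local solutions -/

/-- Holomorphic functions that tend uniformly to the identity are eventually injective on a smaller
disc, by Cauchy's estimate for the derivative. -/
theorem eventually_injOn_of_tendsto_id {k : ℕ → ℂ → ℂ} {c : ℂ} {r : ℝ} (hr : 0 < r)
    (hd : ∀ᶠ m in atTop, ∀ w ∈ Metric.closedBall c r, DifferentiableAt ℂ (k m) w)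
    (hk : ∀ τ > 0, ∀ᶠ m in atTop, ∀ w ∈ Metric.closedBall c r, ‖k m w - w‖ ≤ τ) :
    ∀ᶠ m in atTop, InjOn (k m) (Metric.ball c (r / 2)) := by
  filter_upwards [hd, hk (r / 4) (by positivity)] with m hm1 hm2 x hx y hy hxy
  have hsub : ∀ t ∈ Metric.ball c (r / 2), Metric.closedBall t (r / 2) ⊆ Metric.closedBall c r := by
    intro t ht
    refine Metric.closedBall_subset_closedBall' ?_
    have := Metric.mem_ball.1 ht
    linarith
  have hmem : ∀ t ∈ Metric.ball c (r / 2), t ∈ Metric.closedBall c r := fun t ht =>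
    hsub t ht (Metric.mem_closedBall_self (by positivity))
  refine eq_of_hasDerivAt_near_const (l := 1) (a := deriv (k m)) one_ne_zero
    (convex_ball c (r / 2)) (fun t ht => (hm1 t (hmem t ht)).hasDerivAt) (fun t ht => ?_) hx hy hxy
  have h1 : DiffContOnCl ℂ (fun z => k m z - z) (Metric.ball t (r / 2)) := by
    refine DifferentiableOn.diffContOnCl fun z hz => ?_
    rw [closure_ball t (by positivity)] at hz
    exact ((hm1 z (hsub t ht hz)).sub differentiableAt_id).differentiableWithinAt
  have h2 := Complex.norm_deriv_le_of_forall_mem_sphere_norm_le (half_pos hr) h1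
    (fun z hz => hm2 z (hsub t ht (Metric.sphere_subset_closedBall hz)))
  have h3 : deriv (fun z => k m z - z) t = deriv (k m) t - 1 :=
    ((hm1 t (hmem t ht)).hasDerivAt.fun_sub (hasDerivAt_id t)).deriv
  rw [h3] at h2
  calc ‖deriv (k m) t - 1‖ ≤ r / 4 / (r / 2) := h2
    _ = ‖(1 : ℂ)‖ / 2 := by rw [norm_one]; field_simp; norm_num

/-- A function continuous on an open set is uniformly continuous near a compact subset. -/
theorem exists_ball_subset_of_isCompact {E F : Type*} [PseudoMetricSpace E] [PseudoMetricSpace F]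
    {φ : E → F} {K Ω : Set E} (hK : IsCompact K) (hΩ : IsOpen Ω) (hKΩ : K ⊆ Ω)
    (hφ : ContinuousOn φ Ω) {ε : ℝ} (hε : 0 < ε) :
    ∃ τ > 0, ∀ w ∈ K, ∀ t ∈ Metric.ball w τ, t ∈ Ω ∧ φ t ∈ Metric.ball (φ w) ε := by
  obtain ⟨δ, hδ, hδΩ⟩ := hK.exists_thickening_subset_open hΩ hKΩ
  have h1 := hK.uniformContinuousAt_of_continuousAt φ
    (fun a ha => hφ.continuousAt (hΩ.mem_nhds (hKΩ ha))) (Metric.dist_mem_uniformity hε)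
  obtain ⟨δ', hδ', h2⟩ := Metric.mem_uniformity_dist.1 h1
  refine ⟨min δ δ', lt_min hδ hδ', fun w hw t ht => ?_⟩
  rw [Metric.mem_ball] at ht
  refine ⟨hδΩ (Metric.mem_thickening_iff.2 ⟨w, hw, ht.trans_le (min_le_left _ _)⟩), ?_⟩
  rw [Metric.mem_ball, dist_comm]
  exact h2 (a := w) (b := t) (by rw [dist_comm]; exact ht.trans_le (min_le_right _ _)) hw

/-- Two local solutions define the same self-map of `X` on the overlap of their discs. -/
theorem LocalSolution.eventually_eq [T2Space X] {x y : X} {r r' : ℝ} {o o' : ℂ} {ρ ρ' : ℝ}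
    {k k' : ℕ → ℂ → ℂ} (h : LocalSolution U W ν η θ g x r o ρ k)
    (h' : LocalSolution U W ν η θ g y r' o' ρ' k') (hxy : x ≠ y) :
    ∀ᶠ m in atTop, ∀ p ∈ U, p ∈ (chartAt ℂ x).source → p ∈ (chartAt ℂ y).source →
      chartAt ℂ x p ∈ Metric.closedBall (chartAt ℂ x x) r →
      chartAt ℂ y p ∈ Metric.closedBall (chartAt ℂ y y) r' →
      (chartAt ℂ x).symm (k m (chartAt ℂ x p)) = (chartAt ℂ y).symm (k' m (chartAt ℂ y p)) := by
  set e := chartAt ℂ x with he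
  set e' := chartAt ℂ y with he'
  have hea : e ∈ atlas ℂ X := chart_mem_atlas ℂ x
  have hea' : e' ∈ atlas ℂ X := chart_mem_atlas ℂ y
  set Ω : Set ℂ := e.target ∩ e.symm ⁻¹' e'.source with hΩ
  have hΩo : IsOpen Ω := e.isOpen_inter_preimage_symm e'.open_source
  set φ : ℂ → ℂ := e' ∘ e.symm with hφ
  have hφd : ∀ t ∈ Ω, DifferentiableAt ℂ φ t := fun t ht =>
    differentiableAt_transition hea hea' ht.1 ht.2
  set D : Set X := e.symm '' Metric.closedBall (e x) r with hD
  set D' : Set X := e'.symm '' Metric.closedBall (e' y) r' with hD'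
  have hDc : IsCompact D := (isCompact_closedBall _ _).image_of_continuousOn
    (e.continuousOn_symm.mono fun w hw => (h.subset hw).1)
  have hDc' : IsCompact D' := (isCompact_closedBall _ _).image_of_continuousOn
    (e'.continuousOn_symm.mono fun w hw => (h'.subset hw).1)
  have hDs : D ⊆ e.source := by
    rintro _ ⟨w, hw, rfl⟩
    exact e.map_target (h.subset hw).1
  have hDs' : D' ⊆ e'.source := by
    rintro _ ⟨w, hw, rfl⟩
    exact e'.map_target (h'.subset hw).1
  have hDmem : ∀ p ∈ D, e p ∈ Metric.closedBall (e x) r := by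
    rintro _ ⟨w, hw, rfl⟩
    rwa [e.right_inv (h.subset hw).1]
  have hDmem' : ∀ p ∈ D', e' p ∈ Metric.closedBall (e' y) r' := by
    rintro _ ⟨w, hw, rfl⟩
    rwa [e'.right_inv (h'.subset hw).1]
  -- the overlap contains no zeros and poles, as these are centres of discs
  have hnS : ∀ p ∈ D ∩ D', p ∉ θ.zeros ∪ θ.poles := by
    rintro p ⟨hp, hp'⟩ hS
    have h1 := (h.mem_iff _ (hDmem p hp)).1 (by rwa [← he, e.left_inv (hDs hp)])
    have h2 := (h'.mem_iff _ (hDmem' p hp')).1 (by rwa [← he', e'.left_inv (hDs' hp')])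
    have h3 := h.eq_center (h1 ▸ hDmem p hp)
    have h4 := h'.eq_center (h2 ▸ hDmem' p hp')
    have h5 : p = x := e.injOn (hDs hp) (mem_chart_source ℂ x) (h1.trans h3)
    have h6 : p = y := e'.injOn (hDs' hp') (mem_chart_source ℂ y) (h2.trans h4)
    exact hxy (h5.symm.trans h6)
  have hKc : IsCompact (D ∩ D') := hDc.inter hDc'
  obtain ⟨κ, hκ, hκle⟩ : ∃ κ > 0, ∀ p ∈ D ∩ D', κ ≤ ‖e' p - o'‖ := by
    rcases (D ∩ D').eq_empty_or_nonempty with hemp | hne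
    · exact ⟨1, one_pos, fun p hp => by simp [hemp] at hp⟩
    · have hcont : ContinuousOn (fun p => ‖e' p - o'‖) (D ∩ D') :=
        ((e'.continuousOn.mono (inter_subset_right.trans hDs')).sub continuousOn_const).norm
      obtain ⟨p₀, hp₀, hmin⟩ := hKc.exists_isMinOn hne hcont
      refine ⟨‖e' p₀ - o'‖, norm_pos_iff.2 (sub_ne_zero.2 fun h0 => hnS p₀ hp₀ ?_), fun p hp =>
        hmin hp⟩
      have := (h'.mem_iff _ (hDmem' p₀ hp₀.2)).2 h0
      rwa [← he', e'.left_inv (hDs' hp₀.2)] at this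
  have hQc : IsCompact (e '' (D ∩ D')) :=
    hKc.image_of_continuousOn (e.continuousOn.mono (inter_subset_left.trans hDs))
  have hQΩ : e '' (D ∩ D') ⊆ Ω := by
    rintro _ ⟨p, hp, rfl⟩
    refine ⟨e.map_source (hDs hp.1), ?_⟩
    rw [mem_preimage, e.left_inv (hDs hp.1)]
    exact hDs' hp.2
  have hρ := h.ratio_pos
  have hρ' := h'.ratio_pos
  obtain ⟨τ, hτ, hτφ⟩ := exists_ball_subset_of_isCompact hQc hΩo hQΩ
    (fun t ht => (hφd t ht).continuousAt.continuousWithinAt) (show 0 < ρ' * κ by positivity)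
  filter_upwards [h.solution, h'.solution, h.small_uniform (τ / 2) (half_pos hτ)]
    with m hm hm' hs p hpU hps hps' hpr hpr'
  have hp : p ∈ D ∩ D' := ⟨⟨e p, hpr, e.left_inv hps⟩, ⟨e' p, hpr', e'.left_inv hps'⟩⟩
  have hpe : e.symm (e p) = p := e.left_inv hps
  have hpe' : e'.symm (e' p) = p := e'.left_inv hps'
  have hpo : e p ≠ o := fun h0 => hnS p hp (by
    have := (h.mem_iff _ hpr).2 h0
    rwa [← he, hpe] at this)
  have hpo' : e' p ≠ o' := fun h0 => hnS p hp (by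
    have := (h'.mem_iff _ hpr').2 h0
    rwa [← he', hpe'] at this)
  obtain ⟨-, F, hF, -, hkF, hFg⟩ := hm (e p) hpr hpo
  obtain ⟨-, F', hF', hFi', hkF', hFg'⟩ := hm' (e' p) hpr' hpo'
  rw [← he, hpe] at hFg
  rw [← he', hpe'] at hFg'
  have hφp : φ (e p) = e' p := by rw [hφ, Function.comp_apply, hpe]
  -- a ball around `e p` that is mapped by the transition function into the ball of the
  -- second solution
  set B : Set ℂ := Metric.ball (e p) (min (ρ * ‖e p - o‖) τ) with hB
  have hpB : e p ∈ B := Metric.mem_ball_self (lt_min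
    (mul_pos hρ (norm_pos_iff.2 (sub_ne_zero.2 hpo))) hτ)
  have hkB : k m (e p) ∈ B := by
    rw [hB, mem_ball_iff_norm]
    exact lt_min (mem_ball_iff_norm.1 hkF) ((hs _ hpr).trans_lt (half_lt_self hτ))
  have hBΩ : ∀ t ∈ B, t ∈ Ω ∧ φ t ∈ Metric.ball (e' p) (ρ' * ‖e' p - o'‖) := by
    intro t ht
    obtain ⟨h1, h2⟩ := hτφ (e p) ⟨p, hp, rfl⟩ t (Metric.ball_subset_ball (min_le_right _ _) ht)
    rw [hφp] at h2
    refine ⟨h1, Metric.ball_subset_ball ?_ h2⟩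
    gcongr
    exact hκle p hp
  have hFφ : ∀ t ∈ B, HasDerivAt (F' ∘ φ) (coeff (ν m).toFun e t) t := by
    intro t ht
    obtain ⟨h1, h2⟩ := hBΩ t ht
    rw [coeff_eq_coeff_mul_deriv _ hea hea' h1.1 h1.2]
    exact (hF' (φ t) h2).comp t (hφd t h1).hasDerivAt
  have h1 := sub_eq_sub_of_hasDerivAt (convex_ball _ _) hFφ
    (fun t ht => hF t (Metric.ball_subset_ball (min_le_left _ _) ht)) hkB hpB
  rw [hFg hpU, ← hFg' hpU, Function.comp_apply, Function.comp_apply, hφp] at h1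
  have h2 := hFi' (hBΩ _ hkB).2 hkF' (sub_left_injective h1)
  rw [← h2, hφ, Function.comp_apply, e'.left_inv (hBΩ _ hkB).1.2]

end RiemannSurface

namespace RiemannSurface

/-! ### Gluing -/

/-- The local solutions on finitely many discs that cover `closure U` glue to conformal maps. -/
theorem ConvergingPair.exists_conformal {X : Type*} [UniformSpace X] [T2Space X] [CompactSpace X]
    [ChartedSpace ℂ X] [IsManifold 𝓘(ℂ, ℂ) ω X] {U W : Set X} {ν η : ℕ → MeromorphicForm W}
    {θ : MeromorphicForm W} {g : ℕ → X → ℂ} (h : ConvergingPair U W ν η θ g) :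
    ∃ f : ℕ → X → X,
      (∀ᶠ m in atTop, IsConformalMap (f m) U W ∧ (∀ x ∈ θ.zeros ∪ θ.poles, f m x = x) ∧
        ∀ x ∈ U, pullback (f m) (ν m).toFun x = (η m).toFun x) ∧
      TendstoUniformlyOn f id atTop U := by
  classical
  have hUW : U ⊆ W := subset_closure.trans h.closure_subset
  have hea : ∀ x : X, chartAt ℂ x ∈ atlas ℂ X := chart_mem_atlas ℂ
  choose! r o ρ k hk using fun (x : X) (hx : x ∈ closure U) => h.exists_localSolution hx
  set D : X → Set X := fun x =>
    (chartAt ℂ x).source ∩ chartAt ℂ x ⁻¹' Metric.ball (chartAt ℂ x x) (r x / 2) with hD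
  have hDo : ∀ x, IsOpen (D x) := fun x =>
    (chartAt ℂ x).isOpen_inter_preimage Metric.isOpen_ball
  have hDx : ∀ x ∈ closure U, x ∈ D x := fun x hx =>
    ⟨mem_chart_source ℂ x, Metric.mem_ball_self (half_pos (hk x hx).pos)⟩
  obtain ⟨T, hTU, hTcov⟩ := (isClosed_closure (s := U)).isCompact.elim_nhds_subcover D
    (fun x hx => (hDo x).mem_nhds (hDx x hx))
  have hcov : ∀ p ∈ U, ∃ i : T, p ∈ D i := by
    intro p hp
    obtain ⟨i, hi, hpi⟩ := mem_iUnion₂.1 (hTcov (subset_closure hp))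
    exact ⟨⟨i, hi⟩, hpi⟩
  have hkT : ∀ i : T, LocalSolution U W ν η θ g i (r i) (o i) (ρ i) (k i) := fun i =>
    hk i (hTU i i.2)
  have hball : ∀ i : T, Metric.ball (chartAt ℂ (i : X) i) (r i / 2) ⊆
      Metric.closedBall (chartAt ℂ (i : X) i) (r i) := fun i =>
    Metric.ball_subset_closedBall.trans
      (Metric.closedBall_subset_closedBall (half_le_self (hkT i).pos.le))
  set f : ℕ → X → X := fun m p => if hp : p ∈ U then
    (chartAt ℂ ((hcov p hp).choose : X)).symm
      (k (hcov p hp).choose m (chartAt ℂ ((hcov p hp).choose : X) p)) else p with hf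
  have hglue : ∀ᶠ m in atTop, ∀ i : T, ∀ p ∈ U, p ∈ D i →
      f m p = (chartAt ℂ (i : X)).symm (k i m (chartAt ℂ (i : X) p)) := by
    have h1 : ∀ i j : T, ∀ᶠ m in atTop, (i : X) ≠ j → ∀ p ∈ U, p ∈ D i → p ∈ D j →
        (chartAt ℂ (i : X)).symm (k i m (chartAt ℂ (i : X) p)) =
          (chartAt ℂ (j : X)).symm (k j m (chartAt ℂ (j : X) p)) := by
      intro i j
      by_cases hij : (i : X) = j
      · exact Eventually.of_forall fun m h0 => absurd hij h0
      · filter_upwards [(hkT i).eventually_eq (hkT j) hij] with m hm _ p hp hpi hpj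
        exact hm p hp hpi.1 hpj.1 (hball i hpi.2) (hball j hpj.2)
    have h2 := eventually_all.2 fun i => eventually_all.2 fun j => h1 i j
    filter_upwards [h2] with m hm i p hp hpi
    simp only [hf, dif_pos hp]
    have hpj := (hcov p hp).choose_spec
    by_cases hij : (((hcov p hp).choose : T) : X) = i
    · rw [Subtype.ext hij]
    · exact hm _ i hij p hp hpj hpi
  have hinj : ∀ᶠ m in atTop, ∀ i : T,
      InjOn (k i m) (Metric.ball (chartAt ℂ (i : X) i) (r i / 2)) :=
    eventually_all.2 fun i => eventually_injOn_of_tendsto_id (hkT i).pos (hkT i).differentiable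
      (hkT i).small_uniform
  have hdiff := eventually_all.2 fun i => (hkT i).differentiable
  have hsol := eventually_all.2 fun i => (hkT i).solution
  -- the local solutions keep their values in the discs on which the charts are defined
  have htarget : ∀ᶠ m in atTop, ∀ i : T, ∀ w ∈ Metric.closedBall (chartAt ℂ (i : X) i) (r i),
      k i m w ∈ (chartAt ℂ (i : X)).target ∩ (chartAt ℂ (i : X)).symm ⁻¹' W := by
    filter_upwards [hsol] with m hm i w hw
    by_cases hwo : w = o i
    · rw [hwo, (hkT i).fixed m, ← hwo]
      exact (hkT i).subset hw
    · obtain ⟨-, F, -, -, hkF, -⟩ := hm i w hw hwo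
      exact (hkT i).ball_subset w hw hkF
  have htends : TendstoUniformlyOn f id atTop U := by
    intro V hV
    have h1 : ∀ i : T, ∀ᶠ m in atTop,
        ∀ w ∈ Metric.closedBall (chartAt ℂ (i : X) i) (r i),
          ((chartAt ℂ (i : X)).symm w, (chartAt ℂ (i : X)).symm (k i m w)) ∈ V := by
      intro i
      have h2 := (isCompact_closedBall (chartAt ℂ (i : X) i)
        (r i)).uniformContinuousAt_of_continuousAt
        (chartAt ℂ (i : X)).symm
        (fun w hw => (chartAt ℂ (i : X)).continuousAt_symm ((hkT i).subset hw).1) hV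
      obtain ⟨τ, hτ, h3⟩ := Metric.mem_uniformity_dist.1 h2
      filter_upwards [(hkT i).small_uniform (τ / 2) (half_pos hτ)] with m hm w hw
      exact h3 (a := w) (b := k i m w) (by
        rw [dist_comm, dist_eq_norm]
        exact (hm w hw).trans_lt (half_lt_self hτ)) hw
    filter_upwards [eventually_all.2 h1, hglue] with m hm1 hm2 p hp
    obtain ⟨i, hpi⟩ := hcov p hp
    have h3 := hm1 i _ (hball i hpi.2)
    rwa [(chartAt ℂ (i : X)).left_inv hpi.1, ← hm2 i p hp hpi] at h3
  refine ⟨f, ?_, htends⟩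
  -- points of `U` with the same image are close to each other, hence lie in a common disc
  have hinjf : ∀ᶠ m in atTop, InjOn (f m) U := by
    obtain ⟨V, hV, hVD⟩ := lebesgue_number_lemma (K := closure U) (U := fun i : T => D i)
      isClosed_closure.isCompact (fun i => hDo i) (fun p hp => by
        obtain ⟨i, hi, hpi⟩ := mem_iUnion₂.1 (hTcov hp)
        exact mem_iUnion.2 ⟨⟨i, hi⟩, hpi⟩)
    obtain ⟨V', hV', hsymm, hcomp⟩ := comp_symm_mem_uniformity_sets hV
    filter_upwards [htends V' hV', hglue, hinj, htarget] with m hm1 hm2 hm3 hm4 p hp q hq hpq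
    have hpqV : (p, q) ∈ V := by
      refine hcomp ⟨f m p, hm1 p hp, ?_⟩
      rw [hpq]
      exact hsymm.symm _ _ (hm1 q hq)
    obtain ⟨i, hi⟩ := hVD p (subset_closure hp)
    have hpi : p ∈ D i := hi (UniformSpace.mem_ball_self p hV)
    have hqi : q ∈ D i := hi hpqV
    rw [hm2 i p hp hpi, hm2 i q hq hqi] at hpq
    have h1 := (chartAt ℂ (i : X)).symm.injOn (hm4 i _ (hball i hpi.2)).1
      (hm4 i _ (hball i hqi.2)).1 hpq
    exact (chartAt ℂ (i : X)).injOn hpi.1 hqi.1 (hm3 i hpi.2 hqi.2 h1)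
  filter_upwards [hglue, hinjf, hdiff, hsol, htarget] with m hglue hinjf hdiff hsol htarget
  have hfix : ∀ i : T, ∀ p ∈ D i, p ∈ θ.zeros ∪ θ.poles → chartAt ℂ (i : X) p = o i := by
    intro i p hpi hpS
    refine ((hkT i).mem_iff _ (hball i hpi.2)).1 ?_
    rwa [(chartAt ℂ (i : X)).left_inv hpi.1]
  have hlocal : ∀ i : T, ∀ p ∈ U, p ∈ D i →
      MDifferentiableAt 𝓘(ℂ, ℂ) 𝓘(ℂ, ℂ) (f m) p ∧
        pullback (f m) (ν m).toFun p = (η m).toFun p := by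
    intro i p hp hpi
    set e := chartAt ℂ (i : X) with he
    have hpe : e.symm (e p) = p := e.left_inv hpi.1
    have hw := hball i hpi.2
    have h1 := mdifferentiableAt_and_pullback (h := f m) (k := k i m) (hea i)
      (e.map_source hpi.1) (htarget i _ hw).1 (hdiff i _ hw).hasDerivAt (by
        filter_upwards [eventually_mem_target_and_symm_mem (e.map_source hpi.1)
          (h.smooth.1.inter (hDo i)) (by rw [hpe]; exact ⟨hp, hpi⟩)] with t ht
        have h2 := hglue i _ ht.2.1 ht.2.2
        rwa [← he, e.right_inv ht.1] at h2)
    rw [hpe] at h1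
    refine ⟨h1.1, h1.2 _ _ ?_⟩
    by_cases hpo : e p = o i
    · -- at a zero or a pole both forms have the value `0`
      have hpS : p ∈ θ.zeros ∪ θ.poles := by
        have := ((hkT i).mem_iff _ hw).2 hpo
        rwa [← he, hpe] at this
      have hzero : ∀ β : MeromorphicForm W, β.ord p = θ.ord p → coeff β.toFun e (e p) = 0 := by
        intro β hβ
        rw [coeff_eq_zero_iff _ (hea i) (e.map_source hpi.1), hpe,
          β.apply_eq_zero_iff (hUW hp)]
        rcases hpS with hz | hz
        · exact Or.inl ⟨hz.1, by rw [hβ]; exact hz.2⟩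
        · exact Or.inr ⟨hz.1, by rw [hβ]; exact hz.2⟩
      have hkp : k i m (e p) = e p := by rw [hpo, (hkT i).fixed m]
      rw [hkp, hzero _ (h.ord_left m p hp), hzero _ (h.ord_right m p hp), zero_mul]
    · exact (hsol i _ hw hpo).1
  refine ⟨⟨?_, ?_, hinjf⟩, ?_, ?_⟩
  · intro p hp
    obtain ⟨i, hpi⟩ := hcov p hp
    rw [hglue i p hp hpi]
    exact (htarget i _ (hball i hpi.2)).2
  · intro p hp
    obtain ⟨i, hpi⟩ := hcov p hp
    exact (hlocal i p hp hpi).1.mdifferentiableWithinAt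
  · intro p hpS
    have hp : p ∈ U := hpS.elim (fun hz => h.zeros_subset hz) (fun hz => h.poles_subset hz)
    obtain ⟨i, hpi⟩ := hcov p hp
    rw [hglue i p hp hpi, hfix i p hpi hpS, (hkT i).fixed m, ← hfix i p hpi hpS]
    exact (chartAt ℂ (i : X)).left_inv hpi.1
  · intro p hp
    obtain ⟨i, hpi⟩ := hcov p hp
    exact (hlocal i p hp hpi).2

/-- Forms with the same class in relative cohomology differ by the differential of a function that
vanishes on `Z`. -/
theorem MeromorphicForm.exists_primitive_of_relClass_eq {X : Type*} [TopologicalSpace X]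
    [ChartedSpace ℂ X] [IsManifold 𝓘(ℂ, ℂ) ω X] {W M Z : Set X} (ν η : MeromorphicForm W)
    (hν : M ⊆ W \ ν.poles) (hη : M ⊆ W \ η.poles) (h : ν.relClass hν Z = η.relClass hη Z) :
    ∃ f : X → ℂ, (∀ x ∈ Z, f x = 0) ∧
      ∀ x ∈ M, HasMFDerivAt 𝓘(ℝ, ℂ) 𝓘(ℝ, ℂ) f x (Form.toReal (η.toFun - ν.toFun) x) := by
  obtain ⟨f, -, hfZ, hf⟩ := (Submodule.Quotient.eq _).1 h.symm
  exact ⟨f, hfZ, hf⟩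

end RiemannSurface

theorem mainTheorem11
    {X : Type*} [TopologicalSpace X] [T2Space X] [CompactSpace X] [ConnectedSpace X]
    [ChartedSpace ℂ X] [IsManifold 𝓘(ℂ, ℂ) ω X]
    (U W Z P : Set X)
    (hU : RiemannSurface.IsSmoothDomain U) (hW : RiemannSurface.IsSmoothDomain W)
    (hUW : closure U ⊆ W) (hWX : W ≠ univ)
    (hUWeq : RiemannSurface.InclusionIsHomotopyEquiv U W)
    (hZU : Z ⊆ U) (hPU : P ⊆ U) (hZP : Disjoint Z P)
    (hZ : IsDiscrete Z) (hP : IsDiscrete P)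
    (ν η : ℕ → RiemannSurface.MeromorphicForm W) (θ : RiemannSurface.MeromorphicForm W)
    (hθ : ∃ x ∈ W, θ.toFun x ≠ 0)
    (hνθ : RiemannSurface.TendstoUniformlyOnCompacts (fun m => (ν m).toFun) θ.toFun (W \ P))
    (hηθ : RiemannSurface.TendstoUniformlyOnCompacts (fun m => (η m).toFun) θ.toFun (W \ P))
    (hνpoles : ∀ m, (ν m).poles = P) (hηpoles : ∀ m, (η m).poles = P) (hθpoles : θ.poles = P)
    (hνzeros : ∀ m, (ν m).zeros = Z) (hηzeros : ∀ m, (η m).zeros = Z) (hθzeros : θ.zeros = Z)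
    (hord : ∀ m, ∀ z ∈ U, (ν m).ord z = θ.ord z ∧ (η m).ord z = θ.ord z)
    (hclass : ∀ m,
      (ν m).relClass (RiemannSurface.diff_subset_diff_poles hUW (hνpoles m)) Z =
        (η m).relClass (RiemannSurface.diff_subset_diff_poles hUW (hηpoles m)) Z) :
    ∃ h : ℕ → X → X,
      (∀ᶠ m in atTop, RiemannSurface.IsConformalMap (h m) U W ∧
        (∀ x ∈ Z ∪ P, h m x = x) ∧
        ∀ x ∈ U, RiemannSurface.pullback (h m) (ν m).toFun x = (η m).toFun x) ∧
      RiemannSurface.TendstoUniformlyToId h U := by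
  subst hθzeros hθpoles
  have hsub : ∀ e ∈ atlas ℂ X, ∀ K ⊆ e.target ∩ e.symm ⁻¹' (W \ θ.poles), IsCompact K →
      TendstoUniformlyOn (fun m z => RiemannSurface.coeff (η m).toFun e z -
        RiemannSurface.coeff (ν m).toFun e z) (fun _ => 0) atTop K := by
    intro e he K hK hKc
    have h1 := (hηθ e he K hK hKc).fun_sub (hνθ e he K hK hKc)
    simpa only [sub_self] using h1
  have hUW' : U ⊆ W := subset_closure.trans hUW
  obtain ⟨g, hg1, hg2, hg3⟩ := RiemannSurface.exists_primitives_tendsto_zero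
    (θ.isOpen_sdiff_poles hW.1 hZ hP hU.1 hUW')
    (fun x hx => (⟨hZU hx, fun hp => disjoint_left.1 hZP hx hp⟩ : x ∈ U \ θ.poles))
    (δ := fun m => (η m).toFun - (ν m).toFun)
    (fun e he K hK hKc => hsub e he K
      (fun w hw => ⟨(hK hw).1, hUW' (hK hw).2.1, (hK hw).2.2⟩) hKc)
    (fun m => (ν m).exists_primitive_of_relClass_eq (η m) _ _ (hclass m))
  have hpair : RiemannSurface.ConvergingPair U W ν η θ g :=
    { smooth := hU
      isOpen := hW.1
      closure_subset := hUW
      zeros_subset := hZU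
      poles_subset := hPU
      zeros_discrete := hZ
      poles_discrete := hP
      poles_left := hνpoles
      poles_right := hηpoles
      ord_left := fun m x hx => (hord m x hx).1
      ord_right := fun m x hx => (hord m x hx).2
      tendsto := hνθ
      tendsto_sub := hsub
      primitive_zeros := hg1
      primitive := hg2
      primitive_tendsto := hg3 }
  exact @RiemannSurface.ConvergingPair.exists_conformal X uniformSpaceOfCompactR1
    _ _ _ _ _ _ _ _ _ _
    hpair
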